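/- Let $\mathcal L=\{P,L,I\}$ with $P,L$ unary and $I$ binary. An incidence structure is an $\mathcal L$-structure whose domain is partitioned by $P$ (points) and $L$ (lines) and in which $I(x,y)$ holds only for pairs $(x,y)\in P\times L$. For $m,n\ge 1$, let $T^p_{m,n}$ be the theory of $K_{m,n}$-free incidence structures, that is, those in which no $m$ distinct points are all incident to each of $n$ distinct lines. Let $T^c_{m,n}$ be the theory of $K_{m,n}$-free incidence structures in which every $m$ distinct points lie simultaneously on exactly $n-1$ lines and every $n$ distinct lines intersect in exactly $m-1$ points. A safe diagram $\Delta(\bar x;\bar y)$ is the set of all atomic and negated atomic formulas true in a finite model of $T^p_{m,n}$ whose elements are labelled bijectively by the variables $\bar x\bar y$, such that each point among $\bar y$ is incident to at most $n-1$ lines among $\bar x$, and each line among $\bar y$ is incident to at most $m-1$ points among $\bar x$. Write $\widehat\Delta(\bar x)$ for the set of formulas in $\Delta$ that mention only variables from $\bar x$, and let $$T_{m,n}=T^c_{m,n}\cup\{\forall\bar x\,(\widehat\Delta(\bar x)\to\exists\bar y\,\Delta(\bar x;\bar y)) : \Delta \text{ a safe diagram}\}$$ (identifying a finite set of formulas with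 its conjunction). **Theorem.** For every $m\ge 1$, the theory $T_{m,1}$ is $\omega$-stable of Morley rank exactly $m$; dually, for every $n\ge 1$, the theory $T_{1,n}$ is $\omega$-stable of Morley rank exactly $n$. Here a theory in a countable language is $\omega$-stable if it is complete and, for every model $M$, every countable $A\subseteq M$ and every $k$, there are only countably many complete $k$-types over $A$. Its Morley rank is the Morley rank of the formula $x=x$ (in a single variable), computed in $\omega$-saturated models, which exist. -/

import Mathlib

open FirstOrder FirstOrder.Language

universe u v w

/-! ### Stability-theoretic notions for an arbitrary first-order theory -/

namespace StableInc

section General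

variable {L : FirstOrder.Language.{u, v}}

/-- `S_k(A)`: the complete `k`-types over the parameter set `A ⊆ M`, i.e. the complete `k`-types
over the theory of `M` in the language `L` expanded by a constant for each element of `A`. -/
abbrev TypesOver (L : FirstOrder.Language.{u, v}) {M : Type w} [L.Structure M] (A : Set M) (k : ℕ) :=
  (L[[A]].completeTheory M).CompleteType (Fin k)

/-- `M` is `ω`-saturated (`ℵ₀`-saturated): every complete `1`-type over a finite set of parameters
from `M` is realized in `M`. -/
def IsOmegaSaturated (L : FirstOrder.Language.{u, v}) (M : Type w) [L.Structure M] [Nonempty M] : Prop :=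
  ∀ A : Set M, A.Finite → ∀ p : TypesOver L A 1,
    p ∈ (L[[A]].completeTheory M).realizedTypes M (Fin 1)

/-- A theory (in a countable language) is `ω`-stable if it is complete and has only countably many
complete `k`-types over each countable set of parameters in each of its models, for every `k`. -/
def IsOmegaStable (T : L.Theory) : Prop :=
  T.IsComplete ∧
    ∀ (M : Theory.ModelType.{u, v, w} T) (A : Set M), A.Countable →
      ∀ k : ℕ, Countable (TypesOver L A k)

/-- `MorleyRankGE L M α D` is the relation `RM(D) ≥ α`, computed in the structure `M`, for a set
`D ⊆ M` (meant to be definable with parameters):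
* `RM(D) ≥ 0` iff `D` is nonempty;
* `RM(D) ≥ α + 1` iff there are infinitely many pairwise disjoint subsets `D₀, D₁, …` of `D`,
  definable with parameters from `M`, such that `RM(Dᵢ) ≥ α` for all `i`;
* for a limit ordinal `α`, `RM(D) ≥ α` iff `RM(D) ≥ β` for all `β < α`. -/
noncomputable def MorleyRankGE (L : FirstOrder.Language.{u, v}) (M : Type w) [L.Structure M]
    (α : Ordinal.{w}) : Set M → Prop :=
  Ordinal.limitRecOn (motive := fun _ => Set M → Prop) α
    (fun D => D.Nonempty)
    (fun _ rankGE D => ∃ E : ℕ → Set M,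
      (∀ i, (Set.univ : Set M).Definable₁ L (E i)) ∧
      (∀ i, E i ⊆ D) ∧
      (∀ i j, i ≠ j → Disjoint (E i) (E j)) ∧
      (∀ i, rankGE (E i)))
    (fun α _ rankGE D => ∀ (β : Ordinal.{w}) (h : β < α), rankGE β h D)

/-- The theory `T` has Morley rank exactly `α`: `T` has an `ω`-saturated model, and in every
`ω`-saturated model the formula `x = x` (whose solution set is the whole model) has Morley rank at
least `α` but not at least `α + 1`. -/
def HasMorleyRank (T : L.Theory) (α : Ordinal.{w}) : Prop :=
  (∃ M : Theory.ModelType.{u, v, w} T, IsOmegaSaturated L M) ∧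
    ∀ M : Theory.ModelType.{u, v, w} T, IsOmegaSaturated L M →
      MorleyRankGE L M α Set.univ ∧ ¬ MorleyRankGE L M (α + 1) Set.univ

end General

/-! ### Incidence structures and the theories `T^p_{m,n}`, `T^c_{m,n}`, `T_{m,n}` -/

/-- The relation symbols `P` (points), `L` (lines), `I` (incidence). -/
inductive IncRel : ℕ → Type
  | point : IncRel 1
  | line : IncRel 1
  | inc : IncRel 2

/-- The relational language `{P, L, I}`. -/
def incLang : FirstOrder.Language.{0, 0} := ⟨fun _ => Empty, IncRel⟩

/-- The symbol `P`. -/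
abbrev ptSym : incLang.Relations 1 := IncRel.point

/-- The symbol `L`. -/
abbrev lnSym : incLang.Relations 1 := IncRel.line

/-- The symbol `I`. -/
abbrev incSym : incLang.Relations 2 := IncRel.inc

section Atoms

variable {α : Type}

/-- `P(x)`. -/
def pt (x : α) : incLang.Formula α :=
  Relations.formula₁ ptSym (Term.var x)

/-- `L(x)`. -/
def ln (x : α) : incLang.Formula α :=
  Relations.formula₁ lnSym (Term.var x)

/-- `I(x, y)`. -/
def inc (x y : α) : incLang.Formula α :=
  Relations.formula₂ incSym (Term.var x) (Term.var y)

/-- `x = y`. -/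
def eqv (x y : α) : incLang.Formula α :=
  Term.equal (Term.var x) (Term.var y)

/-- The universal closure `∀ x̄ φ(x̄)`. -/
noncomputable def forAll [Finite α] (φ : incLang.Formula α) : incLang.Sentence :=
  Formula.iAlls α (φ.relabel (Sum.inr : α → Empty ⊕ α))

/-- The `x_i` are pairwise distinct. -/
noncomputable def distinct {β : Type} [Finite β] (x : β → α) : incLang.Formula α :=
  Formula.iInf fun p : {p : β × β // p.1 ≠ p.2} => (eqv (x p.1.1) (x p.1.2)).not

/-- The `x_i` are pairwise distinct points. -/
noncomputable def distinctPts {β : Type} [Finite β] (x : β → α) : incLang.Formula α :=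
  distinct x ⊓ Formula.iInf fun i => pt (x i)

/-- The `y_j` are pairwise distinct lines. -/
noncomputable def distinctLns {β : Type} [Finite β] (y : β → α) : incLang.Formula α :=
  distinct y ⊓ Formula.iInf fun j => ln (y j)

/-- The `x_i` are pairwise distinct points, the `y_j` are pairwise distinct lines, and every `x_i`
is incident to every `y_j`. -/
noncomputable def completeInc {β γ : Type} [Finite β] [Finite γ] (x : β → α) (y : γ → α) :
    incLang.Formula α :=
  distinctPts x ⊓ distinctLns y ⊓ Formula.iInf fun p : β × γ => inc (x p.1) (y p.2)

end Atoms

/-- `T^p_{m,n}`: the theory of `K_{m,n}`-free incidence structures. -/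
def Tp (m n : ℕ) : incLang.Theory :=
  { -- `P` and `L` partition the domain
    forAll (α := Fin 1) ((pt 0).iff (ln 0).not),
    -- incidences only hold on pairs in `P × L`
    forAll (α := Fin 2) ((inc 0 1).imp (pt 0 ⊓ ln 1)),
    -- no `m` distinct points are simultaneously incident to `n` distinct lines
    forAll (α := Fin m ⊕ Fin n) (completeInc Sum.inl Sum.inr).not }

/-- `T^c_{m,n}`: `K_{m,n}`-free incidence structures in which every `m` distinct points lie
simultaneously on exactly `n - 1` lines and every `n` distinct lines intersect in exactly `m - 1`
points (the upper bounds being part of `K_{m,n}`-freeness). Used for `m, n ≥ 1` only. -/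
def Tc (m n : ℕ) : incLang.Theory :=
  Tp m n ∪
  { forAll (α := Fin m) ((distinctPts id).imp
      (Formula.iExs (Fin (n - 1)) (completeInc Sum.inl Sum.inr))),
    forAll (α := Fin n) ((distinctLns id).imp
      (Formula.iExs (Fin (m - 1)) (completeInc Sum.inr Sum.inl))) }

open Classical in
/-- `φ` or its negation, according to the truth value of `p`. -/
noncomputable def literal {α : Type} (p : Prop) (φ : incLang.Formula α) : incLang.Formula α :=
  if p then φ else φ.not

section Diagram

variable {A : Type} [incLang.Structure A]

/-- `a` is a point of the structure `A`. -/
def IsPt (a : A) : Prop := Structure.RelMap ptSym ![a]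

/-- `a` is a line of the structure `A`. -/
def IsLn (a : A) : Prop := Structure.RelMap lnSym ![a]

/-- `a` is incident to `b` in the structure `A`. -/
def IsInc (a b : A) : Prop := Structure.RelMap incSym ![a, b]

/-- The conjunction of all atomic and negated atomic formulas in the variables `z : β` that hold of
the tuple `a : β → A`. If `a` is injective, this is the diagram of the substructure of `A` whose
elements are labelled by the variables through `a`. -/
noncomputable def diag {β : Type} [Finite β] (a : β → A) : incLang.Formula β :=
  (Formula.iInf fun z : β => literal (IsPt (a z)) (pt z) ⊓ literal (IsLn (a z)) (ln z)) ⊓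
  Formula.iInf fun p : β × β =>
    literal (a p.1 = a p.2) (eqv p.1 p.2) ⊓ literal (IsInc (a p.1) (a p.2)) (inc p.1 p.2)

end Diagram

/-- The structure `A`, whose elements are the variables `x_1, …, x_k` (left) and `y_1, …, y_l`
(right), has a safe diagram with respect to `m, n`: it is a model of `T^p_{m,n}`, each `y_i` which
is a point is incident to at most `n - 1` of the `x_j`, and each `y_i` which is a line is incident
to at most `m - 1` of the `x_j`. -/
def IsSafe (m n : ℕ) {k l : ℕ} (A : incLang.Structure (Fin k ⊕ Fin l)) : Prop :=
  (Fin k ⊕ Fin l) ⊨ Tp m n ∧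
  (∀ i : Fin l, IsPt (Sum.inr i : Fin k ⊕ Fin l) →
    {j : Fin k | IsLn (Sum.inl j : Fin k ⊕ Fin l) ∧
      IsInc (Sum.inr i : Fin k ⊕ Fin l) (Sum.inl j)}.ncard ≤ n - 1) ∧
  (∀ i : Fin l, IsLn (Sum.inr i : Fin k ⊕ Fin l) →
    {j : Fin k | IsPt (Sum.inl j : Fin k ⊕ Fin l) ∧
      IsInc (Sum.inl j : Fin k ⊕ Fin l) (Sum.inr i)}.ncard ≤ m - 1)

/-- The sentence `∀ x̄ (Δ̂(x̄) → ∃ ȳ Δ(x̄; ȳ))`, where `Δ` is the diagram of `A` and `Δ̂` is the part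
of `Δ` which only mentions the variables `x̄`. -/
noncomputable def extensionAxiom {k l : ℕ} (A : incLang.Structure (Fin k ⊕ Fin l)) :
    incLang.Sentence :=
  forAll (α := Fin k)
    ((diag (Sum.inl : Fin k → Fin k ⊕ Fin l)).imp
      (Formula.iExs (Fin l) (diag (id : Fin k ⊕ Fin l → Fin k ⊕ Fin l))))

/-- `T_{m,n}`: the theory of existentially closed `K_{m,n}`-free incidence structures, given by
`T^c_{m,n}` together with the extension axioms of all safe diagrams. Used for `m, n ≥ 1` only. -/
def TheoryT (m n : ℕ) : incLang.Theory :=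
  Tc m n ∪ {σ | ∃ (k l : ℕ) (A : incLang.Structure (Fin k ⊕ Fin l)),
    IsSafe m n A ∧ σ = extensionAxiom A}

end StableInc

/-! Put `d = m - 1` (dually `d = n - 1`). When one index is `1`, the axioms lose their geometry.
Call lines "blocks" (dually, points are blocks and lines play the role of points). A model is then
just an infinite set of points together with blocks having exactly `d` points each, every `d`-set of
points carrying infinitely many blocks; this is `model_iff_isBlockStructure`. The Boolean `b`
switches the two roles, so both halves of the theorem are proved at once.

Finite partial isomorphisms between closed sets (those containing the points of their blocks) have
the back-and-forth property, hence preserve all formulas (`realize_iff_of_partialIso`). Starting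
from the empty map this gives completeness. It also shows that the type of `x` over a finite closed
set `B` is determined by its sort and by the intersection of `B` with `hull x`, that is, `x` and its
points. For a tuple over a countable set, countably many data remain (`countable_typesOver`), and
every model is `ω`-saturated since a finite set has only finitely many traces.

Rank counts the new elements of `hull x`. An element free over `B` contributes at most itself and
its `d` points, which bounds the rank by `d + 1` (`exists_le_ncard_of_morleyRankGE`); the key is
that independent extensions of one type over `B` amalgamate. Conversely, fixing the points of a
block one by one splits the set of blocks into infinitely many disjoint pieces `d` times, and the
infinitely many blocks on a fixed `d`-set give one more step
(`morleyRankGE_of_blocksThrough_subset`). -/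

namespace StableInc

/-! ### Block systems and their finite partial isomorphisms -/

/-- A set with a distinguished subset of points (the remaining elements are called blocks) and an
incidence relation. -/
structure BlockData (M : Type*) where
  /-- `P x`: the element `x` is a point. -/
  P : M → Prop
  /-- `J x y`: the point `x` lies on the block `y`. -/
  J : M → M → Prop

namespace BlockData

variable {M : Type*} {N : Type*}

/-- Every block has exactly `d` points, and every set of `d` points is the point set of infinitely
many blocks. -/
structure IsSystem (D : BlockData M) (d : ℕ) : Prop where
  inc : ∀ {x y}, D.J x y → D.P x ∧ ¬ D.P y
  exists_points : ∀ y, ¬ D.P y → ∃ S : Finset M, S.card = d ∧ ∀ x, x ∈ S ↔ D.J x y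
  infinite_points : {x | D.P x}.Infinite
  infinite_fiber : ∀ S : Finset M, S.card = d → (∀ x ∈ S, D.P x) →
    {y | ¬ D.P y ∧ ∀ x, x ∈ S ↔ D.J x y}.Infinite

/-- A finite partial isomorphism whose domain and range contain, along with every block, all of its
points. -/
structure PartialIso (D : BlockData M) (E : BlockData N) (R : Set (M × N)) : Prop where
  finite : R.Finite
  eq_iff : ∀ p ∈ R, ∀ q ∈ R, (p.1 = q.1 ↔ p.2 = q.2)
  point_iff : ∀ p ∈ R, (D.P p.1 ↔ E.P p.2)
  inc_iff : ∀ p ∈ R, ∀ q ∈ R, (D.J p.1 q.1 ↔ E.J p.2 q.2)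
  left_closed : ∀ p ∈ R, ∀ x, D.J x p.1 → ∃ q ∈ R, q.1 = x
  right_closed : ∀ p ∈ R, ∀ y, E.J y p.2 → ∃ q ∈ R, q.2 = y

variable {D : BlockData M} {E : BlockData N} {R : Set (M × N)} {d : ℕ}

theorem IsSystem.exists_point_notMem (hD : D.IsSystem d) {F : Set M} (hF : F.Finite) :
    ∃ x, D.P x ∧ x ∉ F := by
  obtain ⟨x, hx, hxF⟩ := hD.infinite_points.exists_notMem_finite hF
  exact ⟨x, hx, hxF⟩

theorem IsSystem.exists_points_notMem (hD : D.IsSystem d) {F : Set M} (hF : F.Finite) (n : ℕ) :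
    ∃ S : Finset M, S.card = n ∧ ∀ x ∈ S, D.P x ∧ x ∉ F := by
  obtain ⟨S, hS, hn⟩ := (hD.infinite_points.sdiff hF).exists_subset_card_eq n
  exact ⟨S, hn, fun x hx => hS hx⟩

/-- A set of at most `d` points inside a finite set `F` is the trace on `F` of a block outside
`F`. -/
theorem IsSystem.exists_block (hD : D.IsSystem d) {F : Set M} (hF : F.Finite) (T : Finset M)
    (hT : T.card ≤ d) (hTP : ∀ x ∈ T, D.P x) :
    ∃ y, ¬ D.P y ∧ y ∉ F ∧ ∀ x ∈ F, (x ∈ T ↔ D.J x y) := by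
  classical
  -- Pad `T` to exactly `d` points with points outside `F`; blocks on the padded set meet `F`
  -- precisely in `T`.
  obtain ⟨S, hS, hSF⟩ := hD.exists_points_notMem (hF.union T.finite_toSet) (d - T.card)
  have hdisj : Disjoint T S :=
    Finset.disjoint_left.2 fun x hxT hxS => (hSF x hxS).2 (Or.inr hxT)
  have hcard : (T ∪ S).card = d := by
    rw [Finset.card_union_of_disjoint hdisj, hS]; omega
  have hP : ∀ x ∈ T ∪ S, D.P x := fun x hx =>
    (Finset.mem_union.1 hx).elim (hTP x) fun h => (hSF x h).1
  obtain ⟨y, hy, hyF⟩ := (hD.infinite_fiber _ hcard hP).exists_notMem_finite hF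
  refine ⟨y, hy.1, hyF, fun x hx => ?_⟩
  rw [← hy.2 x, Finset.mem_union]
  exact ⟨Or.inl, fun h => h.resolve_right fun hS => (hSF x hS).2 (Or.inl hx)⟩

/-- If there were only finitely many such blocks, adjoining them to `F` in `exists_block` would give
another one. -/
theorem IsSystem.exists_blocks (hD : D.IsSystem d) {F : Set M}
    (hF : F.Finite) (T : Finset M) (hT : T.card ≤ d) (hTP : ∀ x ∈ T, D.P x) :
    ∃ g : ℕ → M, Function.Injective g ∧
      ∀ i, ¬ D.P (g i) ∧ g i ∉ F ∧ ∀ x ∈ F, (x ∈ T ↔ D.J x (g i)) := by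
  have : {y | ¬ D.P y ∧ y ∉ F ∧ ∀ x ∈ F, (x ∈ T ↔ D.J x y)}.Infinite := by
    intro hfin
    obtain ⟨y, h1, h2, h3⟩ := hD.exists_block (hF.union hfin) T hT hTP
    exact h2 (Or.inr ⟨h1, fun h => h2 (Or.inl h), fun x hx => h3 x (Or.inl hx)⟩)
  exact ⟨fun i => this.natEmbedding _ i, fun i j h => (this.natEmbedding _).injective
    (Subtype.ext h), fun i => (this.natEmbedding _ i).2⟩

theorem PartialIso.empty : PartialIso D E ∅ := by
  constructor <;> simp

theorem PartialIso.swap (h : PartialIso D E R) : PartialIso E D (Prod.swap '' R) := by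
  refine ⟨h.finite.image _, ?_, ?_, ?_, ?_, ?_⟩
  · rintro _ ⟨p, hp, rfl⟩ _ ⟨q, hq, rfl⟩
    exact (h.eq_iff p hp q hq).symm
  · rintro _ ⟨p, hp, rfl⟩
    exact (h.point_iff p hp).symm
  · rintro _ ⟨p, hp, rfl⟩ _ ⟨q, hq, rfl⟩
    exact (h.inc_iff p hp q hq).symm
  · rintro _ ⟨p, hp, rfl⟩ x hx
    obtain ⟨q, hq, rfl⟩ := h.right_closed p hp x hx
    exact ⟨_, ⟨q, hq, rfl⟩, rfl⟩
  · rintro _ ⟨p, hp, rfl⟩ x hx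
    obtain ⟨q, hq, rfl⟩ := h.left_closed p hp x hx
    exact ⟨_, ⟨q, hq, rfl⟩, rfl⟩

/-- Closedness of the domain and range prevents a new element from lying on an old block, so only
incidences of old points with the new pair need to be compared. -/
theorem PartialIso.insert (h : PartialIso D E R) {a : M} {b : N}
    (ha : ∀ p ∈ R, p.1 ≠ a) (hb : ∀ p ∈ R, p.2 ≠ b) (hP : D.P a ↔ E.P b)
    (hJ : ∀ p ∈ R, (D.J p.1 a ↔ E.J p.2 b)) (hl : ∀ x, D.J x a → ∃ q ∈ R, q.1 = x)
    (hr : ∀ y, E.J y b → ∃ q ∈ R, q.2 = y) : PartialIso D E (insert (a, b) R) := by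
  have h1 : ∀ p ∈ R, ¬ D.J a p.1 := fun p hp hj => by
    obtain ⟨q, hq, e⟩ := h.left_closed p hp a hj
    exact ha q hq e
  have h2 : ∀ p ∈ R, ¬ E.J b p.2 := fun p hp hj => by
    obtain ⟨q, hq, e⟩ := h.right_closed p hp b hj
    exact hb q hq e
  have h3 : ¬ D.J a a := fun hj => by
    obtain ⟨q, hq, e⟩ := hl a hj
    exact ha q hq e
  have h4 : ¬ E.J b b := fun hj => by
    obtain ⟨q, hq, e⟩ := hr b hj
    exact hb q hq e
  refine ⟨h.finite.insert _, ?_, ?_, ?_, ?_, ?_⟩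
  · rintro p (rfl | hp) q (rfl | hq)
    · simp
    · exact iff_of_false (ha q hq).symm (hb q hq).symm
    · exact iff_of_false (ha p hp) (hb p hp)
    · exact h.eq_iff p hp q hq
  · rintro p (rfl | hp)
    · exact hP
    · exact h.point_iff p hp
  · rintro p (rfl | hp) q (rfl | hq)
    · exact iff_of_false h3 h4
    · exact iff_of_false (h1 q hq) (h2 q hq)
    · exact hJ p hp
    · exact h.inc_iff p hp q hq
  · rintro p (rfl | hp) x hx
    · obtain ⟨q, hq, e⟩ := hl x hx
      exact ⟨q, Or.inr hq, e⟩
    · obtain ⟨q, hq, e⟩ := h.left_closed p hp x hx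
      exact ⟨q, Or.inr hq, e⟩
  · rintro p (rfl | hp) x hx
    · obtain ⟨q, hq, e⟩ := hr x hx
      exact ⟨q, Or.inr hq, e⟩
    · obtain ⟨q, hq, e⟩ := h.right_closed p hp x hx
      exact ⟨q, Or.inr hq, e⟩

theorem PartialIso.insert_point (h : PartialIso D E R) {d' : ℕ} (hD : D.IsSystem d)
    (hE : E.IsSystem d') {a : M} {b : N} (hPa : D.P a) (hPb : E.P b)
    (ha : ∀ p ∈ R, p.1 ≠ a) (hb : ∀ p ∈ R, p.2 ≠ b) : PartialIso D E (Insert.insert (a, b) R) :=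
  h.insert ha hb (iff_of_true hPa hPb)
    (fun _ _ => iff_of_false (fun hj => (hD.inc hj).2 hPa) fun hj => (hE.inc hj).2 hPb)
    (fun _ hj => absurd hPa (hD.inc hj).2) fun _ hj => absurd hPb (hE.inc hj).2

/-- Equinumerous sets of new points can be matched. -/
theorem PartialIso.exists_extend_points {d' : ℕ} (hD : D.IsSystem d) (hE : E.IsSystem d')
    (S : Finset M) : ∀ {R : Set (M × N)} (_ : PartialIso D E R) (T : Finset N),
      S.card = T.card → (∀ x ∈ S, D.P x) → (∀ y ∈ T, E.P y) →
      (∀ p ∈ R, p.1 ∉ S) → (∀ p ∈ R, p.2 ∉ T) →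
      ∃ R', PartialIso D E R' ∧ R ⊆ R' ∧ (∀ p ∈ R', p ∈ R ∨ p.1 ∈ S ∧ p.2 ∈ T) ∧
        (∀ x ∈ S, ∃ p ∈ R', p.1 = x) ∧ ∀ y ∈ T, ∃ p ∈ R', p.2 = y := by
  classical
  induction S using Finset.induction_on with
  | empty =>
    intro R h T hc _ _ _ _
    have : T = ∅ := Finset.card_eq_zero.1 (by simpa using hc.symm)
    subst this
    exact ⟨R, h, le_rfl, fun p hp => Or.inl hp, by simp, by simp⟩
  | insert a S haS ih =>
    intro R h T hc hSP hTP hSR hTR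
    rw [Finset.card_insert_of_notMem haS] at hc
    obtain ⟨b, hb⟩ : T.Nonempty := Finset.card_pos.1 (by omega)
    have h' : PartialIso D E (Insert.insert (a, b) R) :=
      h.insert_point hD hE (hSP a (by simp)) (hTP b hb)
        (fun p hp e => hSR p hp (by simp [e])) (fun p hp e => hTR p hp (e ▸ hb))
    obtain ⟨R', hR', hsub, hm, hl, hr⟩ := ih h' (T.erase b)
      (by rw [Finset.card_erase_of_mem hb]; omega)
      (fun x hx => hSP x (Finset.mem_insert_of_mem hx))
      (fun y hy => hTP y (Finset.mem_of_mem_erase hy))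
      (by
        rintro p (rfl | hp) hpS
        · exact haS hpS
        · exact hSR p hp (Finset.mem_insert_of_mem hpS))
      (by
        rintro p (rfl | hp) hpS
        · simp at hpS
        · exact hTR p hp (Finset.mem_of_mem_erase hpS))
    have hab : (a, b) ∈ R' := hsub (Set.mem_insert _ _)
    refine ⟨R', hR', (Set.subset_insert _ _).trans hsub, fun p hp => ?_, fun x hx => ?_,
      fun y hy => ?_⟩
    · rcases hm p hp with (rfl | hp') | ⟨h1, h2⟩
      · exact Or.inr ⟨Finset.mem_insert_self _ _, hb⟩
      · exact Or.inl hp'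
      · exact Or.inr ⟨Finset.mem_insert_of_mem h1, Finset.mem_of_mem_erase h2⟩
    · rcases Finset.mem_insert.1 hx with rfl | hx
      · exact ⟨_, hab, rfl⟩
      · exact hl x hx
    · by_cases hyb : y = b
      · exact ⟨_, hab, hyb.symm⟩
      · exact hr y (Finset.mem_erase.2 ⟨hyb, hy⟩)

/-- Two new blocks with matching traces can be matched, after matching their points. -/
theorem PartialIso.exists_extend_block (h : PartialIso D E R) (hD : D.IsSystem d)
    (hE : E.IsSystem d) {a : M} {b : N} (hPa : ¬ D.P a) (hPb : ¬ E.P b)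
    (ha : ∀ p ∈ R, p.1 ≠ a) (hb : ∀ p ∈ R, p.2 ≠ b)
    (hJ : ∀ p ∈ R, (D.J p.1 a ↔ E.J p.2 b)) :
    ∃ R', PartialIso D E R' ∧ R ⊆ R' ∧ (a, b) ∈ R' := by
  classical
  obtain ⟨S, hS, hSa⟩ := hD.exists_points a hPa
  obtain ⟨T, hT, hTb⟩ := hE.exists_points b hPb
  -- `Q` collects the points of `a` that are already matched. Both blocks have `d` points, so
  -- equally many of their points remain unmatched.
  set Q : Finset (M × N) := h.finite.toFinset.filter fun p => D.J p.1 a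
  have hQ : ∀ p, p ∈ Q ↔ p ∈ R ∧ D.J p.1 a := fun p => by simp [Q]
  have h1 : (Q.image Prod.fst).card = Q.card := Finset.card_image_of_injOn fun p hp q hq e =>
    Prod.ext e ((h.eq_iff p ((hQ p).1 hp).1 q ((hQ q).1 hq).1).1 e)
  have h2 : (Q.image Prod.snd).card = Q.card := Finset.card_image_of_injOn fun p hp q hq e =>
    Prod.ext ((h.eq_iff p ((hQ p).1 hp).1 q ((hQ q).1 hq).1).2 e) e
  have s1 : Q.image Prod.fst ⊆ S := by
    intro x hx
    obtain ⟨p, hp, rfl⟩ := Finset.mem_image.1 hx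
    exact (hSa _).2 ((hQ p).1 hp).2
  have s2 : Q.image Prod.snd ⊆ T := by
    intro x hx
    obtain ⟨p, hp, rfl⟩ := Finset.mem_image.1 hx
    exact (hTb _).2 ((hJ p ((hQ p).1 hp).1).1 ((hQ p).1 hp).2)
  obtain ⟨R', hR', hsub, hm, hl, hr⟩ := h.exists_extend_points hD hE (S \ Q.image Prod.fst)
    (T \ Q.image Prod.snd)
    (by rw [Finset.card_sdiff_of_subset s1, Finset.card_sdiff_of_subset s2, h1, h2, hS, hT])
    (fun x hx => (hD.inc ((hSa x).1 (Finset.mem_sdiff.1 hx).1)).1)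
    (fun x hx => (hE.inc ((hTb x).1 (Finset.mem_sdiff.1 hx).1)).1)
    (fun p hp hx => (Finset.mem_sdiff.1 hx).2 (Finset.mem_image.2
      ⟨p, (hQ p).2 ⟨hp, (hSa _).1 (Finset.mem_sdiff.1 hx).1⟩, rfl⟩))
    (fun p hp hx => (Finset.mem_sdiff.1 hx).2 (Finset.mem_image.2
      ⟨p, (hQ p).2 ⟨hp, (hJ p hp).2 ((hTb _).1 (Finset.mem_sdiff.1 hx).1)⟩, rfl⟩))
  refine ⟨Insert.insert (a, b) R', hR'.insert ?_ ?_ (iff_of_false hPa hPb) ?_ ?_ ?_,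
    hsub.trans (Set.subset_insert _ _), Set.mem_insert _ _⟩
  · rintro p hp rfl
    rcases hm p hp with hp | ⟨hp, _⟩
    · exact ha p hp rfl
    · exact hPa (hD.inc ((hSa _).1 (Finset.mem_sdiff.1 hp).1)).1
  · rintro p hp rfl
    rcases hm p hp with hp | ⟨_, hp⟩
    · exact hb p hp rfl
    · exact hPb (hE.inc ((hTb _).1 (Finset.mem_sdiff.1 hp).1)).1
  · intro p hp
    rcases hm p hp with hp | ⟨hp1, hp2⟩
    · exact hJ p hp
    · exact iff_of_true ((hSa _).1 (Finset.mem_sdiff.1 hp1).1)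
        ((hTb _).1 (Finset.mem_sdiff.1 hp2).1)
  · intro x hx
    by_cases hxQ : x ∈ Q.image Prod.fst
    · obtain ⟨p, hp, rfl⟩ := Finset.mem_image.1 hxQ
      exact ⟨p, hsub ((hQ p).1 hp).1, rfl⟩
    · exact hl x (Finset.mem_sdiff.2 ⟨(hSa x).2 hx, hxQ⟩)
  · intro x hx
    by_cases hxQ : x ∈ Q.image Prod.snd
    · obtain ⟨p, hp, rfl⟩ := Finset.mem_image.1 hxQ
      exact ⟨p, hsub ((hQ p).1 hp).1, rfl⟩
    · exact hr x (Finset.mem_sdiff.2 ⟨(hTb x).2 hx, hxQ⟩)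

/-- A new point goes to any new point. A new block has at most `d` points in the domain; their
images are the trace of a new block by `exists_block`, and the remaining points are then matched. -/
theorem PartialIso.forth (h : PartialIso D E R) (hD : D.IsSystem d) (hE : E.IsSystem d) (a : M) :
    ∃ b R', PartialIso D E R' ∧ R ⊆ R' ∧ (a, b) ∈ R' := by
  classical
  by_cases ha : ∃ p ∈ R, p.1 = a
  · obtain ⟨p, hp, rfl⟩ := ha
    exact ⟨p.2, R, h, le_rfl, hp⟩
  push Not at ha
  have hran : (Prod.snd '' R).Finite := h.finite.image _
  by_cases hPa : D.P a
  · obtain ⟨b, hPb, hb⟩ := hE.exists_point_notMem hran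
    exact ⟨b, _, h.insert_point hD hE hPa hPb ha fun p hp e => hb ⟨p, hp, e⟩,
      Set.subset_insert _ _, Set.mem_insert _ _⟩
  obtain ⟨S, hS, hSa⟩ := hD.exists_points a hPa
  set Q : Finset (M × N) := h.finite.toFinset.filter fun p => D.J p.1 a
  have hQ : ∀ p, p ∈ Q ↔ p ∈ R ∧ D.J p.1 a := fun p => by simp [Q]
  have h1 : (Q.image Prod.fst).card = Q.card := Finset.card_image_of_injOn fun p hp q hq e =>
    Prod.ext e ((h.eq_iff p ((hQ p).1 hp).1 q ((hQ q).1 hq).1).1 e)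
  have hQS : Q.card ≤ d := by
    rw [← h1, ← hS]
    refine Finset.card_le_card fun x hx => ?_
    obtain ⟨p, hp, rfl⟩ := Finset.mem_image.1 hx
    exact (hSa _).2 ((hQ p).1 hp).2
  obtain ⟨b, hPb, hb, hbT⟩ := hE.exists_block hran (Q.image Prod.snd)
    (Finset.card_image_le.trans hQS) (by
      intro x hx
      obtain ⟨p, hp, rfl⟩ := Finset.mem_image.1 hx
      exact (h.point_iff p ((hQ p).1 hp).1).1 (hD.inc ((hQ p).1 hp).2).1)
  obtain ⟨R', h1, h2, h3⟩ := h.exists_extend_block hD hE hPa hPb ha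
    (fun p hp e => hb ⟨p, hp, e⟩) (fun p hp => by
      rw [← hbT _ ⟨p, hp, rfl⟩, Finset.mem_image]
      refine ⟨fun hj => ⟨p, (hQ p).2 ⟨hp, hj⟩, rfl⟩, ?_⟩
      rintro ⟨q, hq, e⟩
      rw [← (h.eq_iff q ((hQ q).1 hq).1 p hp).2 e]
      exact ((hQ q).1 hq).2)
  exact ⟨b, R', h1, h2, h3⟩

theorem PartialIso.back (h : PartialIso D E R) (hD : D.IsSystem d) (hE : E.IsSystem d) (b : N) :
    ∃ a R', PartialIso D E R' ∧ R ⊆ R' ∧ (a, b) ∈ R' := by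
  obtain ⟨a, R', h1, h2, h3⟩ := h.swap.forth hE hD b
  exact ⟨a, _, h1.swap, fun p hp => ⟨p.swap, h2 ⟨p, hp, rfl⟩, rfl⟩, ⟨_, h3, rfl⟩⟩

end BlockData

/-! ### Structures in the language of incidence structures as block systems -/

section BlockData

variable (b : Bool) (M : Type*) [incLang.Structure M]

/-- The block data of an `incLang`-structure: the blocks are the lines if `b = false`, and the
points if `b = true`. -/
def blockData : BlockData M where
  P x := Structure.RelMap (cond b lnSym ptSym) ![x]
  J x y := cond b (Structure.RelMap incSym ![y, x]) (Structure.RelMap incSym ![x, y])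

/-- The structure `M` is partitioned into points and lines, and is a block system with blocks of
size `d`. -/
structure IsBlockStructure (d : ℕ) : Prop where
  point_iff : ∀ x : M, Structure.RelMap ptSym ![x] ↔ ¬ Structure.RelMap lnSym ![x]
  isSystem : (blockData b M).IsSystem d

end BlockData

/-! ### Elementary equivalence by back-and-forth -/

section BackAndForth

variable {b : Bool} {M : Type*} [incLang.Structure M] {N : Type*} [incLang.Structure N] {d : ℕ}

theorem relMap_iff_of_partialIso (hM : IsBlockStructure b M d) (hN : IsBlockStructure b N d)
    {R : Set (M × N)} (h : (blockData b M).PartialIso (blockData b N) R) {l : ℕ}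
    (r : incLang.Relations l) (x : Fin l → M) (y : Fin l → N) (hxy : ∀ i, (x i, y i) ∈ R) :
    Structure.RelMap r x ↔ Structure.RelMap r y := by
  have hP := fun i => h.point_iff _ (hxy i)
  have hJ := fun i j => h.inc_iff _ (hxy i) _ (hxy j)
  cases r with
  | point =>
    have ex : x = ![x 0] := by ext i; fin_cases i; rfl
    have ey : y = ![y 0] := by ext i; fin_cases i; rfl
    rw [ex, ey]
    have := hP 0
    cases b
    · exact this
    · exact (hM.point_iff _).trans ((not_congr this).trans (hN.point_iff _).symm)
  | line =>
    have ex : x = ![x 0] := by ext i; fin_cases i; rfl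
    have ey : y = ![y 0] := by ext i; fin_cases i; rfl
    rw [ex, ey]
    have := hP 0
    cases b
    · exact not_iff_not.1 (((hM.point_iff _).symm.trans this).trans (hN.point_iff _))
    · exact this
  | inc =>
    have ex : x = ![x 0, x 1] := by ext i; fin_cases i <;> rfl
    have ey : y = ![y 0, y 1] := by ext i; fin_cases i <;> rfl
    rw [ex, ey]
    cases b
    · exact hJ 0 1
    · exact hJ 1 0

/-- Induction on the formula, with back-and-forth at the quantifier. Only free variables are
required to be matched, because `R` is finite while `α` may index infinitely many parameters. -/
theorem realize_iff_of_partialIso (hM : IsBlockStructure b M d) (hN : IsBlockStructure b N d)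
    {α : Type*} [DecidableEq α] {n : ℕ} (φ : incLang.BoundedFormula α n) :
    ∀ {R : Set (M × N)} (_ : (blockData b M).PartialIso (blockData b N) R)
      {x : α → M} {y : α → N} (_ : ∀ i ∈ φ.freeVarFinset, (x i, y i) ∈ R)
      {xs : Fin n → M} {ys : Fin n → N} (_ : ∀ i, (xs i, ys i) ∈ R),
      φ.Realize x xs ↔ φ.Realize y ys := by
  have term : ∀ {m : ℕ} {R : Set (M × N)} (t : incLang.Term (α ⊕ Fin m)) {x : α → M} {y : α → N}
      (_ : ∀ i ∈ t.varFinsetLeft, (x i, y i) ∈ R) {xs : Fin m → M} {ys : Fin m → N}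
      (_ : ∀ i, (xs i, ys i) ∈ R),
      (t.realize (Sum.elim x xs), t.realize (Sum.elim y ys)) ∈ R := by
    intro m R t x y hx xs ys hxs
    rcases t with (i | i) | ⟨f, _⟩
    · exact hx i (by simp [Term.varFinsetLeft])
    · exact hxs i
    · exact Empty.elim f
  induction φ with
  | falsum => intros; exact Iff.rfl
  | equal t₁ t₂ =>
    intro R h x y hx xs ys hxs
    exact h.eq_iff _ (term t₁ (fun i hi => hx i (by simp [BoundedFormula.freeVarFinset, hi])) hxs)
      _ (term t₂ (fun i hi => hx i (by simp [BoundedFormula.freeVarFinset, hi])) hxs)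
  | rel r ts =>
    intro R h x y hx xs ys hxs
    refine relMap_iff_of_partialIso hM hN h r _ _ fun j =>
      term (ts j) (fun i hi => hx i ?_) hxs
    simp only [BoundedFormula.freeVarFinset, Finset.mem_biUnion, Finset.mem_univ, true_and]
    exact ⟨j, hi⟩
  | imp f₁ f₂ ih₁ ih₂ =>
    intro R h x y hx xs ys hxs
    exact imp_congr
      (ih₁ h (fun i hi => hx i (by simp [BoundedFormula.freeVarFinset, hi])) hxs)
      (ih₂ h (fun i hi => hx i (by simp [BoundedFormula.freeVarFinset, hi])) hxs)
  | all f ih =>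
    intro R h x y hx xs ys hxs
    rw [BoundedFormula.realize_all, BoundedFormula.realize_all]
    have key : ∀ {a c} {R' : Set (M × N)}, (blockData b M).PartialIso (blockData b N) R' →
        R ⊆ R' → (a, c) ∈ R' → (f.Realize x (Fin.snoc xs a) ↔ f.Realize y (Fin.snoc ys c)) := by
      intro a c R' h' hR hac
      refine ih h' (fun i hi => hR (hx i hi)) fun i => ?_
      refine Fin.lastCases ?_ (fun j => ?_) i
      · simpa using hac
      · simpa using hR (hxs j)
    constructor
    · intro H c
      obtain ⟨a, R', h1, h2, h3⟩ := h.back hM.isSystem hN.isSystem c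
      exact (key h1 h2 h3).1 (H a)
    · intro H a
      obtain ⟨c, R', h1, h2, h3⟩ := h.forth hM.isSystem hN.isSystem a
      exact (key h1 h2 h3).2 (H c)

theorem realize_sentence_iff (hM : IsBlockStructure b M d) (hN : IsBlockStructure b N d)
    (φ : incLang.Sentence) : M ⊨ φ ↔ N ⊨ φ :=
  realize_iff_of_partialIso hM hN φ BlockData.PartialIso.empty (fun i _ => i.elim)
    (fun i => i.elim0)

end BackAndForth

/-! ### Semantics of the axioms -/

section Semantics

variable {M : Type w} [incLang.Structure M] {α : Type}

@[simp] theorem realize_pt {x : α} {v : α → M} :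
    (pt x).Realize v ↔ Structure.RelMap ptSym ![v x] := by simp [pt]

@[simp] theorem realize_ln {x : α} {v : α → M} :
    (ln x).Realize v ↔ Structure.RelMap lnSym ![v x] := by simp [ln]

@[simp] theorem realize_inc {x y : α} {v : α → M} :
    (inc x y).Realize v ↔ Structure.RelMap incSym ![v x, v y] := by simp [inc]

@[simp] theorem realize_eqv {x y : α} {v : α → M} : (eqv x y).Realize v ↔ v x = v y := by
  simp [eqv]

@[simp] theorem realize_forAll [Finite α] {φ : incLang.Formula α} :
    M ⊨ forAll φ ↔ ∀ v : α → M, φ.Realize v := by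
  simp [forAll, Sentence.Realize, Formula.realize_iAlls, Formula.realize_relabel,
    Function.comp_def]

@[simp] theorem realize_distinct {β : Type} [Finite β] {x : β → α} {v : α → M} :
    (distinct x).Realize v ↔ Function.Injective (v ∘ x) := by
  simp only [distinct, Formula.realize_iInf, Formula.realize_not, realize_eqv, Subtype.forall,
    Prod.forall]
  exact ⟨fun h i j e => by_contra fun hij => h i j hij e, fun h i j hij e => hij (h e)⟩

@[simp] theorem realize_distinctPts {β : Type} [Finite β] {x : β → α} {v : α → M} :
    (distinctPts x).Realize v ↔
      Function.Injective (v ∘ x) ∧ ∀ i, Structure.RelMap ptSym ![v (x i)] := by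
  simp [distinctPts]

@[simp] theorem realize_distinctLns {β : Type} [Finite β] {x : β → α} {v : α → M} :
    (distinctLns x).Realize v ↔
      Function.Injective (v ∘ x) ∧ ∀ i, Structure.RelMap lnSym ![v (x i)] := by
  simp [distinctLns]

@[simp] theorem realize_completeInc {β γ : Type} [Finite β] [Finite γ] {x : β → α} {y : γ → α}
    {v : α → M} : (completeInc x y).Realize v ↔
      ((Function.Injective (v ∘ x) ∧ ∀ i, Structure.RelMap ptSym ![v (x i)]) ∧
        (Function.Injective (v ∘ y) ∧ ∀ i, Structure.RelMap lnSym ![v (y i)])) ∧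
      ∀ i j, Structure.RelMap incSym ![v (x i), v (y j)] := by
  simp [completeInc]

@[simp] theorem realize_literal {p : Prop} {φ : incLang.Formula α} {v : α → M} :
    (literal p φ).Realize v ↔ (p ↔ φ.Realize v) := by
  unfold literal
  split <;> simp [*]

theorem realize_diag {A : Type} [incLang.Structure A] [Finite α] {a : α → A} {v : α → M} :
    (diag a).Realize v ↔
      (∀ z, (IsPt (a z) ↔ Structure.RelMap ptSym ![v z]) ∧
        (IsLn (a z) ↔ Structure.RelMap lnSym ![v z])) ∧
      ∀ z z', (a z = a z' ↔ v z = v z') ∧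
        (IsInc (a z) (a z') ↔ Structure.RelMap incSym ![v z, v z']) := by
  simp [diag]

theorem realize_extensionAxiom {k l : ℕ} {A : incLang.Structure (Fin k ⊕ Fin l)} :
    M ⊨ extensionAxiom A ↔ ∀ v : Fin k → M,
      (diag (Sum.inl : Fin k → Fin k ⊕ Fin l)).Realize v →
      ∃ y : Fin l → M, (diag (id : Fin k ⊕ Fin l → Fin k ⊕ Fin l)).Realize (Sum.elim v y) := by
  simp [extensionAxiom]

end Semantics
/-! ### The models of `T_{d+1,1}` and `T_{1,d+1}` -/

section Models

/-- Incidence structures in which every block has at most `d` points. -/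
structure IsPreBlockStructure (b : Bool) (M : Type*) [incLang.Structure M] (d : ℕ) : Prop where
  point_iff : ∀ x : M, Structure.RelMap ptSym ![x] ↔ ¬ Structure.RelMap lnSym ![x]
  inc : ∀ {x y}, (blockData b M).J x y → (blockData b M).P x ∧ ¬ (blockData b M).P y
  free : ∀ y, ∀ f : Fin (d + 1) → M, Function.Injective f → ¬ ∀ i, (blockData b M).J (f i) y

variable {b : Bool} {M : Type w} [incLang.Structure M] {d : ℕ}

/-- For `b = false` the indices are `(d + 1, 1)`, and the forbidden configuration is a line with `d
+ 1` points; for `b = true` the roles are exchanged. -/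
theorem model_Tp_iff :
    M ⊨ Tp (cond b 1 (d + 1)) (cond b (d + 1) 1) ↔ IsPreBlockStructure b M d := by
  have h1 : (∀ v : Fin 1 → M, Structure.RelMap ptSym ![v 0] ↔ ¬ Structure.RelMap lnSym ![v 0]) ↔
      ∀ x : M, Structure.RelMap ptSym ![x] ↔ ¬ Structure.RelMap lnSym ![x] :=
    ⟨fun h x => h fun _ => x, fun h v => h (v 0)⟩
  have h2 : (∀ v : Fin 2 → M, Structure.RelMap incSym ![v 0, v 1] →
        Structure.RelMap ptSym ![v 0] ∧ Structure.RelMap lnSym ![v 1]) ↔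
      ∀ x y : M, Structure.RelMap incSym ![x, y] →
        Structure.RelMap ptSym ![x] ∧ Structure.RelMap lnSym ![y] :=
    ⟨fun h x y => h ![x, y], fun h v => h (v 0) (v 1)⟩
  simp only [Tp, Theory.model_iff, Set.mem_insert_iff, Set.mem_singleton_iff, forall_eq_or_imp,
    forall_eq, realize_forAll, Formula.realize_iff, Formula.realize_not, Formula.realize_imp,
    Formula.realize_inf, realize_pt, realize_ln, realize_inc, realize_completeInc, h1, h2]
  cases b <;> simp only [cond_true, cond_false]
  · constructor
    · rintro ⟨h1, h2, h3⟩
      refine ⟨h1, fun {x y} h => ⟨(h2 x y h).1, fun hy => (h1 y).1 hy (h2 x y h).2⟩,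
        fun y f hf hJ => h3 (Sum.elim f fun _ => y) ⟨⟨⟨hf, fun i => (h2 _ _ (hJ i)).1⟩,
          Function.injective_of_subsingleton _, fun i => (h2 _ _ (hJ 0)).2⟩, fun i j => hJ i⟩⟩
    · intro h
      refine ⟨h.point_iff, fun x y hxy => ⟨(h.inc hxy).1, ?_⟩, ?_⟩
      · exact not_not.1 fun hy => (h.inc hxy).2 ((h.point_iff y).2 hy)
      · rintro v ⟨⟨⟨h1, -⟩, -⟩, h3⟩
        exact h.free (v (Sum.inr 0)) _ h1 fun i => h3 i 0
  · constructor
    · rintro ⟨h1, h2, h3⟩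
      refine ⟨h1, fun {x y} h => ⟨(h2 y x h).2, (h1 y).1 (h2 y x h).1⟩,
        fun y f hf hJ => h3 (Sum.elim (fun _ => y) f) ⟨⟨⟨Function.injective_of_subsingleton _,
          fun i => (h2 _ _ (hJ 0)).1⟩, hf, fun i => (h2 _ _ (hJ i)).2⟩, fun i j => hJ j⟩⟩
    · intro h
      refine ⟨h.point_iff, fun x y hxy => ⟨(h.point_iff x).2 (h.inc hxy).2, (h.inc hxy).1⟩, ?_⟩
      rintro v ⟨⟨-, ⟨h1, -⟩⟩, h3⟩
      exact h.free (v (Sum.inl 0)) _ h1 fun i => h3 0 i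

theorem model_Tc_iff :
    M ⊨ Tc (cond b 1 (d + 1)) (cond b (d + 1) 1) ↔ IsPreBlockStructure b M d ∧
      ∀ y, ¬ (blockData b M).P y →
        ∃ f : Fin d → M, Function.Injective f ∧ ∀ i, (blockData b M).J (f i) y := by
  rw [Tc, Theory.model_union_iff, model_Tp_iff]
  refine and_congr_right fun hM => ?_
  simp only [Theory.model_iff, Set.mem_insert_iff, Set.mem_singleton_iff, forall_eq_or_imp,
    forall_eq, realize_forAll, Formula.realize_imp, realize_distinctPts, realize_distinctLns,
    Formula.realize_iExs, realize_completeInc]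
  cases b <;> simp only [cond_true, cond_false]
  · constructor
    · rintro ⟨-, h⟩ y hy
      obtain ⟨f, ⟨⟨hf, -⟩, -⟩, hJ⟩ := h (fun _ => y) ⟨Function.injective_of_subsingleton _,
        fun _ => not_not.1 fun hl => hy ((hM.point_iff y).2 hl)⟩
      exact ⟨f, hf, fun i => hJ i 0⟩
    · intro h
      -- The first axiom asks for `1 - 1 = 0` lines, so the empty tuple is a witness; all content is
      -- in the second one.
      refine ⟨fun v hv => ⟨fun i => i.elim0, ⟨hv, fun i => i.elim0, fun i => i.elim0⟩,
        fun _ i => i.elim0⟩, fun v hv => ?_⟩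
      obtain ⟨f, hf, hJ⟩ := h (v 0) fun hp => (hM.point_iff _).1 hp (hv.2 0)
      refine ⟨f, ⟨⟨hf, fun i => (hM.inc (hJ i)).1⟩, hv⟩, fun i j => ?_⟩
      rw [Subsingleton.elim j 0]
      exact hJ i
  · constructor
    · rintro ⟨h, -⟩ y hy
      obtain ⟨f, ⟨-, ⟨hf, -⟩⟩, hJ⟩ := h (fun _ => y) ⟨Function.injective_of_subsingleton _,
        fun _ => (hM.point_iff y).2 hy⟩
      exact ⟨f, hf, fun i => hJ 0 i⟩
    · intro h
      refine ⟨fun v hv => ?_, fun v hv => ⟨fun i => i.elim0, ⟨⟨fun i => i.elim0, fun i => i.elim0⟩,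
        hv⟩, fun i => i.elim0⟩⟩
      obtain ⟨f, hf, hJ⟩ := h (v 0) ((hM.point_iff _).1 (hv.2 0))
      refine ⟨f, ⟨hv, ⟨hf, fun i => (hM.inc (hJ i)).1⟩⟩, fun j i => ?_⟩
      rw [Subsingleton.elim j 0]
      exact hJ i

/-- Since points and lines partition both structures, one of the two unary predicates determines the
other. -/
theorem realize_diag_iff {A : Type} [incLang.Structure A]
    (hA : ∀ x : A, Structure.RelMap ptSym ![x] ↔ ¬ Structure.RelMap lnSym ![x])
    (hM : ∀ x : M, Structure.RelMap ptSym ![x] ↔ ¬ Structure.RelMap lnSym ![x])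
    {α : Type} [Finite α] {a : α → A} {v : α → M} :
    (diag a).Realize v ↔ (∀ z, (blockData b A).P (a z) ↔ (blockData b M).P (v z)) ∧
      ∀ z z', (a z = a z' ↔ v z = v z') ∧
        ((blockData b A).J (a z) (a z') ↔ (blockData b M).J (v z) (v z')) := by
  rw [realize_diag]
  cases b
  · refine and_congr (forall_congr' fun z => and_iff_left_of_imp fun h => ?_) Iff.rfl
    exact not_iff_not.1 ((hA _).symm.trans (h.trans (hM _)))
  · refine and_congr (forall_congr' fun z => and_iff_right_of_imp fun h => ?_) ?_
    · exact (hA _).trans ((not_congr h).trans (hM _).symm)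
    · exact ⟨fun h z z' => ⟨(h z z').1, (h z' z).2⟩, fun h z z' => ⟨(h z z').1, (h z' z).2⟩⟩

/-- The `incLang`-structure with the given block data. -/
@[reducible] def BlockData.toStructure {X : Type*} (b : Bool) (D : BlockData X) : incLang.Structure X where
  funMap f := Empty.elim f
  RelMap {_} r := match r with
    | .point => fun x => cond b (¬ D.P (x 0)) (D.P (x 0))
    | .line => fun x => cond b (D.P (x 0)) (¬ D.P (x 0))
    | .inc => fun x => cond b (D.J (x 1) (x 0)) (D.J (x 0) (x 1))

theorem BlockData.blockData_toStructure {X : Type*} (D : BlockData X) :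
    @blockData b X (D.toStructure b) = D := by
  cases b <;> rfl

theorem BlockData.relMap_toStructure {X : Type*} (D : BlockData X) (x : X) :
    (D.toStructure b).RelMap ptSym ![x] ↔ ¬ (D.toStructure b).RelMap lnSym ![x] := by
  cases b
  · exact not_not.symm
  · exact Iff.rfl

/-- The diagram with points on the left and blocks on the right, all of them incident. -/
theorem isSafe_toStructure {k l : ℕ} (D : BlockData (Fin k ⊕ Fin l)) (hk : k ≤ d)
    (hJ : ∀ {x y}, D.J x y → D.P x ∧ ¬ D.P y ∧ ∃ i, x = Sum.inl i) :
    IsSafe (cond b 1 (d + 1)) (cond b (d + 1) 1) (D.toStructure b) := by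
  let _ := D.toStructure b
  have e : blockData b (Fin k ⊕ Fin l) = D := D.blockData_toStructure
  have hle : ∀ s : Set (Fin k), s.ncard ≤ d := fun s =>
    (Set.ncard_le_card s).trans (by simpa using hk)
  -- No right-hand variable lies on a block, which meets the safety bound `0`; the other bound, `d`,
  -- follows from `hk`.
  have h0 : ∀ i j, ¬ D.J (Sum.inr i) j := fun i j h => by
    obtain ⟨-, -, _, h⟩ := hJ h
    cases h
  refine ⟨model_Tp_iff.2 ⟨D.relMap_toStructure, fun h => ?_, fun y f hf h => ?_⟩, ?_, ?_⟩
  · rw [e] at h ⊢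
    exact ⟨(hJ h).1, (hJ h).2.1⟩
  · rw [e] at h
    choose g hg using fun i => (hJ (h i)).2.2
    have hg' : Function.Injective g := fun i j hij => hf (by rw [hg, hg, hij])
    have := Fintype.card_le_of_injective g hg'
    simp at this
    omega
  · intro i _
    cases b
    · refine (le_of_eq ?_ : _ ≤ 0)
      rw [Set.ncard_eq_zero]
      exact Set.eq_empty_of_forall_notMem fun j hj => h0 _ _ hj.2
    · exact hle _
  · intro i _
    cases b
    · exact hle _
    · refine (le_of_eq ?_ : _ ≤ 0)
      rw [Set.ncard_eq_zero]
      exact Set.eq_empty_of_forall_notMem fun j hj => h0 _ _ hj.2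

/-! ### Extension axioms versus infinite sets of points and infinite fibres -/

theorem infinite_of_exists_injective {X : Type*} {s : Set X}
    (h : ∀ n : ℕ, ∃ f : Fin n → X, Function.Injective f ∧ ∀ i, f i ∈ s) : s.Infinite := by
  intro hs
  obtain ⟨f, hf, hfs⟩ := h (s.ncard + 1)
  have := Set.ncard_le_ncard (s := Set.range f) (t := s) (by rintro _ ⟨i, rfl⟩; exact hfs i) hs
  rw [← Nat.card_coe_set_eq, Nat.card_range_of_injective hf, Nat.card_fin] at this
  omega

theorem isBlockStructure_of_model
    (hM : M ⊨ TheoryT (cond b 1 (d + 1)) (cond b (d + 1) 1)) : IsBlockStructure b M d := by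
  classical
  obtain ⟨hTc, hext⟩ := Theory.model_union_iff.1 hM
  obtain ⟨hpre, hpts⟩ := model_Tc_iff.1 hTc
  have ext : ∀ {k l : ℕ} (D : BlockData (Fin k ⊕ Fin l)), k ≤ d →
      (∀ {x y}, D.J x y → D.P x ∧ ¬ D.P y ∧ ∃ i, x = Sum.inl i) → (∀ i, D.P (Sum.inl i)) →
      ∀ v : Fin k → M, Function.Injective v → (∀ i, (blockData b M).P (v i)) →
      ∃ y : Fin l → M, Function.Injective y ∧
        (∀ i, D.P (Sum.inr i) ↔ (blockData b M).P (y i)) ∧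
        ∀ i j, D.J (Sum.inl i) (Sum.inr j) ↔ (blockData b M).J (v i) (y j) := by
    intro k l D hk hJ hP v hv hvP
    let _ := D.toStructure b
    have e : blockData b (Fin k ⊕ Fin l) = D := D.blockData_toStructure
    have hmem : M ⊨ extensionAxiom (D.toStructure b) := hext.realize_of_mem _
      ⟨k, l, _, isSafe_toStructure D hk hJ, rfl⟩
    have h := realize_extensionAxiom.1 hmem v
    rw [realize_diag_iff (b := b) D.relMap_toStructure hpre.point_iff, e] at h
    obtain ⟨y, hy⟩ := h ⟨fun z => iff_of_true (hP z) (hvP z), fun z z' =>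
      ⟨Sum.inl_injective.eq_iff.trans hv.eq_iff.symm,
        iff_of_false (fun h => (hJ h).2.1 (hP z')) fun h => (hpre.inc h).2 (hvP z')⟩⟩
    rw [realize_diag_iff (b := b) D.relMap_toStructure hpre.point_iff, e] at hy
    exact ⟨y, fun i j hij => Sum.inr_injective ((hy.2 (Sum.inr i) (Sum.inr j)).1.2 hij),
      fun i => hy.1 (Sum.inr i), fun i j => (hy.2 (Sum.inl i) (Sum.inr j)).2⟩
  have hex : ∀ y, ¬ (blockData b M).P y →
      ∃ S : Finset M, S.card = d ∧ ∀ x, x ∈ S ↔ (blockData b M).J x y := by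
    intro y hy
    obtain ⟨f, hf, hJ⟩ := hpts y hy
    refine ⟨Finset.univ.image f, by simp [Finset.card_image_of_injective _ hf], fun x => ?_⟩
    simp only [Finset.mem_image, Finset.mem_univ, true_and]
    refine ⟨by rintro ⟨i, rfl⟩; exact hJ i, fun hx => by_contra fun hne => ?_⟩
    -- A further point on `y` would make `d + 1` of them.
    refine hpre.free y (Fin.cons x f) (Fin.cons_injective_iff.2 ⟨hne, hf⟩) fun i => ?_
    refine Fin.cases ?_ (fun j => ?_) i
    · simpa using hx
    · simpa using hJ j
  refine ⟨hpre.point_iff, hpre.inc, hex, ?_, ?_⟩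
  · refine infinite_of_exists_injective fun n => ?_
    -- Diagram of `n` new points over nothing.
    obtain ⟨y, hy, hP, -⟩ := ext (k := 0) (l := n) ⟨fun _ => True, fun _ _ => False⟩ (Nat.zero_le _)
      (fun h => h.elim) (fun _ => trivial) (fun i => i.elim0) (fun i => i.elim0) (fun i => i.elim0)
    exact ⟨y, hy, fun i => (hP i).1 trivial⟩
  · intro S hS hSP
    refine infinite_of_exists_injective fun n => ?_
    -- Diagram of `n` new blocks, all through the `d` given points.
    obtain ⟨y, hy, hP, hJ⟩ := ext (k := d) (l := n)
      ⟨fun x => x.isLeft, fun x y => x.isLeft ∧ y.isRight⟩ le_rfl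
      (by
        rintro (x | x) (y | y) ⟨h1, h2⟩
        · cases h2
        · exact ⟨rfl, by simp, _, rfl⟩
        · cases h1
        · cases h1)
      (fun _ => rfl) (fun i => (S.equivFinOfCardEq hS).symm i)
      (Subtype.val_injective.comp (Equiv.injective _)) (fun i => hSP _ (Subtype.prop _))
    have hPy : ∀ i, ¬ (blockData b M).P (y i) := fun i h => by simpa using (hP i).2 h
    refine ⟨y, hy, fun i => ⟨hPy i, ?_⟩⟩
    obtain ⟨T, hT, hTy⟩ := hex (y i) (hPy i)
    have : S = T := by
      refine Finset.eq_of_subset_of_card_le (fun x hx => (hTy x).2 ?_) (by omega)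
      have := (hJ (S.equivFinOfCardEq hS ⟨x, hx⟩) i).1 ⟨rfl, rfl⟩
      simpa using this
    rw [this]
    exact hTy

/-- Safety forbids new points on old blocks, so new points may be chosen off all old blocks. A new
block then only has to have a prescribed trace of at most `d` points, and infinitely many blocks
have it. -/
theorem realize_extensionAxiom_of_isBlockStructure (hM : IsBlockStructure b M d) {k l : ℕ}
    (A : incLang.Structure (Fin k ⊕ Fin l))
    (hA : IsSafe (cond b 1 (d + 1)) (cond b (d + 1) 1) A) : M ⊨ extensionAxiom A := by
  classical
  have hpre := model_Tp_iff.1 hA.1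
  have hsafe : ∀ i j, (blockData b (Fin k ⊕ Fin l)).P (Sum.inr i) →
      ¬ (blockData b (Fin k ⊕ Fin l)).J (Sum.inr i) (Sum.inl j) := by
    intro i j hP hJ
    cases b
    · have h0 := (Set.ncard_eq_zero (Set.toFinite _)).1 (Nat.le_zero.1 (hA.2.1 i hP))
      refine Set.eq_empty_iff_forall_notMem.1 h0 j ⟨?_, hJ⟩
      exact not_not.1 fun h => (hpre.inc hJ).2 ((hpre.point_iff _).2 h)
    · have h0 := (Set.ncard_eq_zero (Set.toFinite _)).1 (Nat.le_zero.1 (hA.2.2 i hP))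
      refine Set.eq_empty_iff_forall_notMem.1 h0 j ⟨?_, hJ⟩
      exact (hpre.point_iff _).2 (hpre.inc hJ).2
  have hS := hM.isSystem
  rw [realize_extensionAxiom]
  intro v hv
  rw [realize_diag_iff (b := b) hpre.point_iff hM.point_iff] at hv
  simp_rw [realize_diag_iff (b := b) hpre.point_iff hM.point_iff]
  set D := blockData b (Fin k ⊕ Fin l)
  set E := blockData b M
  obtain ⟨hvP, hvJ⟩ := hv
  have hvinj : Function.Injective v := fun i j h => Sum.inl_injective ((hvJ i j).1.2 h)
  have hfin : ∀ y, {x | E.J x y}.Finite := by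
    intro y
    by_cases hy : E.P y
    · exact Set.Finite.subset Set.finite_empty fun x hx => (hS.inc hx).2 hy
    · obtain ⟨S, -, h⟩ := hS.exists_points y hy
      exact S.finite_toSet.subset fun x hx => (h x).2 hx
  have hF0 : (Set.range v ∪ ⋃ i, {x | E.J x (v i)}).Finite :=
    (Set.finite_range v).union (Set.finite_iUnion fun i => hfin _)
  obtain ⟨S, hScard, hSF⟩ := hS.exists_points_notMem hF0 l
  set p : Fin l → M := fun i => (S.equivFinOfCardEq hScard).symm i
  have hp : Function.Injective p := Subtype.val_injective.comp (Equiv.injective _)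
  have hpS : ∀ i, E.P (p i) ∧ p i ∉ Set.range v ∪ ⋃ i, {x | E.J x (v i)} :=
    fun i => hSF _ (Subtype.prop _)
  set w : Fin k ⊕ Fin l → M := Sum.elim v p
  have hw : Function.Injective w := hvinj.sumElim hp fun i j h =>
    (hpS j).2 (Or.inl ⟨i, h⟩)
  have hwF : (Set.range w).Finite := Set.finite_range w
  have hwP : ∀ z, D.P z → E.P (w z) := by
    rintro (i | i) h
    · exact (hvP i).1 h
    · exact (hpS i).1
  set T : Fin l → Finset M := fun i => (Finset.univ.filter fun z => D.J z (Sum.inr i)).image w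
  have hT : ∀ i z, w z ∈ T i ↔ D.J z (Sum.inr i) := fun i z => by
    simp [T, hw.eq_iff]
  have hTc : ∀ i, (T i).card ≤ d := by
    intro i
    rw [Finset.card_image_of_injective _ hw]
    by_contra! hlt
    refine hpre.free (Sum.inr i) (fun j => (Finset.equivFin _).symm (Fin.castLE hlt j))
      (Subtype.val_injective.comp ((Equiv.injective _).comp (Fin.castLE_injective _))) fun j => ?_
    exact (Finset.mem_filter.1 (Subtype.prop ((Finset.equivFin _).symm (Fin.castLE hlt j)))).2
  have hTP : ∀ i, ∀ x ∈ T i, E.P x := by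
    intro i x hx
    obtain ⟨z, hz, rfl⟩ := Finset.mem_image.1 hx
    exact hwP z (hpre.inc (Finset.mem_filter.1 hz).2).1
  -- The sequence `g` depends only on the trace; using its `i`-th term for the variable `i` keeps
  -- new blocks with equal traces distinct.
  choose g hginj hgP hgw hgJ using fun (U : Finset M) (hU : U.card ≤ d ∧ ∀ x ∈ U, E.P x) =>
    (hS.exists_blocks hwF U hU.1 hU.2).imp fun g hg =>
      And.intro hg.1 <| And.intro (fun i => (hg.2 i).1) <| And.intro (fun i => (hg.2 i).2.1)
        fun i => (hg.2 i).2.2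
  have hTw : ∀ i, ∀ x ∈ T i, x ∈ Set.range w := by
    intro i x hx
    obtain ⟨z, -, rfl⟩ := Finset.mem_image.1 hx
    exact ⟨z, rfl⟩
  set y : Fin l → M := fun i => if D.P (Sum.inr i) then p i else g (T i) ⟨hTc i, hTP i⟩ i
  have hyp : ∀ i, D.P (Sum.inr i) → y i = p i := fun i h => if_pos h
  have hyg : ∀ i, ¬ D.P (Sum.inr i) → y i = g (T i) ⟨hTc i, hTP i⟩ i := fun i h => if_neg h
  have hyJ : ∀ i, ¬ D.P (Sum.inr i) → ∀ x ∈ Set.range w, (x ∈ T i ↔ E.J x (y i)) :=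
    fun i h => hyg i h ▸ hgJ _ _ i
  have hyw : ∀ i, ¬ D.P (Sum.inr i) → y i ∉ Set.range w := fun i h => hyg i h ▸ hgw _ _ i
  have hyP : ∀ i, D.P (Sum.inr i) ↔ E.P (y i) := by
    intro i
    by_cases h : D.P (Sum.inr i)
    · exact iff_of_true h (hyp i h ▸ (hpS i).1)
    · exact iff_of_false h (hyg i h ▸ hgP _ _ i)
  have huP : ∀ z, D.P z ↔ E.P (Sum.elim v y z) := by
    rintro (i | i)
    · exact hvP i
    · exact hyP i
  have huw : ∀ z, D.P z → Sum.elim v y z = w z := by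
    rintro (i | i) h
    · rfl
    · exact hyp i h
  have hyinj : Function.Injective y := by
    intro i j hij
    by_cases hi : D.P (Sum.inr i)
    · have hj : D.P (Sum.inr j) := (hyP j).2 (hij ▸ (hyP i).1 hi)
      rw [hyp i hi, hyp j hj] at hij
      exact hp hij
    · have hj : ¬ D.P (Sum.inr j) := fun h => hi ((hyP i).2 (hij ▸ (hyP j).1 h))
      have hTT : T i = T j := by
        ext x
        constructor
        · intro hx
          exact (hyJ j hj x (hTw i x hx)).2 (hij ▸ (hyJ i hi x (hTw i x hx)).1 hx)
        · intro hx
          exact (hyJ i hi x (hTw j x hx)).2 (hij ▸ (hyJ j hj x (hTw j x hx)).1 hx)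
      have hcongr : ∀ U V hU hV, U = V → g U hU = g V hV := by
        rintro U V hU hV rfl
        rfl
      rw [hyg i hi, hyg j hj, hcongr _ _ _ ⟨hTc j, hTP j⟩ hTT] at hij
      exact Fin.ext (hginj _ _ hij)
  have huinj : Function.Injective (Sum.elim v y) := by
    refine hvinj.sumElim hyinj fun i j h => ?_
    by_cases hj : D.P (Sum.inr j)
    · exact (hpS j).2 (Or.inl ⟨i, h.trans (hyp j hj)⟩)
    · exact hyw j hj ⟨Sum.inl i, h⟩
  refine ⟨y, huP, fun z z' => ⟨huinj.eq_iff.symm, ?_⟩⟩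
  by_cases hz : D.P z
  swap
  · exact iff_of_false (fun h => hz (hpre.inc h).1) fun h => hz ((huP z).2 (hS.inc h).1)
  by_cases hz' : D.P z'
  · exact iff_of_false (fun h => (hpre.inc h).2 hz') fun h => (hS.inc h).2 ((huP z').1 hz')
  rcases z' with j | j
  · rcases z with i | i
    · exact (hvJ i j).2
    · refine iff_of_false (hsafe i j hz) fun h => (hpS i).2 (Or.inr ?_)
      rw [huw _ hz] at h
      exact Set.mem_iUnion.2 ⟨j, h⟩
  · rw [id, id, huw z hz, ← hT]
    exact hyJ j hz' _ ⟨z, rfl⟩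

theorem model_iff_isBlockStructure :
    M ⊨ TheoryT (cond b 1 (d + 1)) (cond b (d + 1) 1) ↔ IsBlockStructure b M d := by
  refine ⟨isBlockStructure_of_model, fun hM => Theory.model_union_iff.2 ⟨model_Tc_iff.2
    ⟨⟨hM.point_iff, hM.isSystem.inc, fun y f hf hJ => ?_⟩, fun y hy => ?_⟩, ?_⟩⟩
  · obtain ⟨S, hS, hSy⟩ := hM.isSystem.exists_points y (hM.isSystem.inc (hJ 0)).2
    have := Fintype.card_le_of_injective (fun i => (⟨f i, (hSy _).2 (hJ i)⟩ : S))
      fun i j h => hf (congrArg Subtype.val h)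
    simp [hS] at this
  · obtain ⟨S, hS, hSy⟩ := hM.isSystem.exists_points y hy
    exact ⟨fun i => (S.equivFinOfCardEq hS).symm i,
      Subtype.val_injective.comp (Equiv.injective _), fun i => (hSy _).1 (Subtype.prop _)⟩
  · rw [Theory.model_iff]
    rintro _ ⟨k, l, A, hA, rfl⟩
    exact realize_extensionAxiom_of_isBlockStructure hM A hA

/-- The countable block system with blocks of size `d`. -/
def standardBlockData (d : ℕ) : BlockData (ℕ ⊕ {S : Finset ℕ // S.card = d} × ℕ) where
  P x := x.isLeft
  J x y := ∃ n s, x = Sum.inl n ∧ y = Sum.inr s ∧ n ∈ s.1.1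

theorem isSystem_standardBlockData (d : ℕ) : (standardBlockData d).IsSystem d := by
  classical
  have hJ : ∀ x s, (standardBlockData d).J x (Sum.inr s) ↔ ∃ n ∈ s.1.1, Sum.inl n = x := by
    intro x s
    constructor
    · rintro ⟨n, t, rfl, h, hn⟩
      cases h
      exact ⟨n, hn, rfl⟩
    · rintro ⟨n, hn, rfl⟩
      exact ⟨n, s, rfl, rfl, hn⟩
  refine ⟨?_, ?_, ?_, ?_⟩
  · rintro _ _ ⟨n, s, rfl, rfl, -⟩
    exact ⟨rfl, by simp [standardBlockData]⟩
  · rintro (n | s) hy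
    · exact absurd rfl hy
    · refine ⟨s.1.1.map ⟨Sum.inl, Sum.inl_injective⟩, by simpa using s.1.2, fun x => ?_⟩
      simp [hJ]
  · refine Set.infinite_of_injective_forall_mem (f := Sum.inl) Sum.inl_injective fun n => rfl
  · intro S hS hP
    have hS' : S = (S.preimage Sum.inl Sum.inl_injective.injOn).image Sum.inl := by
      ext x
      rcases x with n | s
      · simp
      · simpa using fun h => by simpa [standardBlockData] using hP _ h
    have hc : (S.preimage Sum.inl Sum.inl_injective.injOn).card = d := by
      refine Eq.trans ?_ hS
      conv_rhs => rw [hS']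
      exact (Finset.card_image_of_injective _ Sum.inl_injective).symm
    refine Set.infinite_of_injective_forall_mem
      (f := fun n : ℕ => Sum.inr (⟨S.preimage Sum.inl Sum.inl_injective.injOn, hc⟩, n))
      (fun i j h => by simpa using h) fun n => ⟨by simp [standardBlockData], fun x => ?_⟩
    rw [hJ]
    conv_lhs => rw [hS']
    simp

theorem isSatisfiable_TheoryT (b : Bool) (d : ℕ) :
    (TheoryT (cond b 1 (d + 1)) (cond b (d + 1) 1)).IsSatisfiable := by
  let _ := (standardBlockData d).toStructure b
  have : IsBlockStructure b (ℕ ⊕ {S : Finset ℕ // S.card = d} × ℕ) d :=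
    ⟨(standardBlockData d).relMap_toStructure, by
      rw [BlockData.blockData_toStructure]
      exact isSystem_standardBlockData d⟩
  have := model_iff_isBlockStructure.2 this
  exact Theory.Model.isSatisfiable (ℕ ⊕ {S : Finset ℕ // S.card = d} × ℕ)

theorem isComplete_TheoryT (b : Bool) (d : ℕ) :
    (TheoryT (cond b 1 (d + 1)) (cond b (d + 1) 1)).IsComplete := by
  refine ⟨isSatisfiable_TheoryT b d, fun φ => ?_⟩
  obtain ⟨N⟩ := isSatisfiable_TheoryT b d
  have hN := model_iff_isBlockStructure.1 N.is_model
  rw [Theory.models_sentence_iff, Theory.models_sentence_iff]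
  by_cases h : N ⊨ φ
  · exact Or.inl fun M => (realize_sentence_iff hN (model_iff_isBlockStructure.1 M.is_model) φ).1 h
  · refine Or.inr fun M hM => h ?_
    exact (realize_sentence_iff hN (model_iff_isBlockStructure.1 M.is_model) φ).2 hM

end Models
/-! ### Types as ultrafilters -/

section Types

variable {L : FirstOrder.Language.{u, v}} {M : Type w} [L.Structure M]

/-- A complete `k`-type over `A ⊆ M` is the limit of an ultrafilter on `M ^ k`. -/
theorem exists_ultrafilter [Nonempty M] {A : Set M} {k : ℕ} (p : TypesOver L A k) :
    ∃ U : Ultrafilter (Fin k → M), ∀ φ : L[[A]].Formula (Fin k),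
      Formula.equivSentence φ ∈ p ↔ ∀ᶠ x : Fin k → M in U, φ.Realize x := by
  obtain ⟨N, a, rfl⟩ := Theory.exists_modelType_is_realized_in _ p
  -- `N` satisfies the complete theory of `M`, so whatever holds of `a` is satisfiable in `M`. The
  -- solution sets are closed under intersection and therefore generate a proper filter.
  have key : ∀ φ : L[[A]].Formula (Fin k), φ.Realize a → ∃ x : Fin k → M, φ.Realize x := by
    intro φ hφ
    set ψ : L[[A]].Sentence := Formula.iExs (Fin k) (φ.relabel (Sum.inr : Fin k → Empty ⊕ Fin k))
    have hψ : ∀ {K : Type _} [L[[A]].Structure K], K ⊨ ψ ↔ ∃ x : Fin k → K, φ.Realize x := by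
      intro K _
      simp [ψ, Sentence.Realize, Formula.realize_iExs, Formula.realize_relabel, Function.comp_def]
    by_contra hne
    have h1 : M ⊨ ψ.not := fun h => hne (by
      simpa [ψ, Sentence.Realize, Formula.realize_iExs, Formula.realize_relabel,
        Function.comp_def] using h)
    have h2 : N ⊨ ψ.not := N.is_model.realize_of_mem _ h1
    exact h2 (hψ.2 ⟨a, hφ⟩)
  let s : {φ : L[[A]].Formula (Fin k) // φ.Realize a} → Set (Fin k → M) :=
    fun φ => {x | φ.1.Realize x}
  have hne : (⨅ φ, Filter.principal (s φ)).NeBot := by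
    have : Nonempty {φ : L[[A]].Formula (Fin k) // φ.Realize a} := ⟨⟨⊤, Formula.realize_top.2 trivial⟩⟩
    refine Filter.iInf_neBot_of_directed' ?_ fun φ => Filter.principal_neBot_iff.2 (key _ φ.2)
    intro φ ψ
    refine ⟨⟨φ.1 ⊓ ψ.1, Formula.realize_inf.2 ⟨φ.2, ψ.2⟩⟩, ?_, ?_⟩
    · exact Filter.principal_mono.2 fun x hx => (Formula.realize_inf.1 hx).1
    · exact Filter.principal_mono.2 fun x hx => (Formula.realize_inf.1 hx).2
  have hU : ∀ φ : L[[A]].Formula (Fin k), φ.Realize a →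
      ∀ᶠ x : Fin k → M in Ultrafilter.of (⨅ φ, Filter.principal (s φ)), φ.Realize x := fun φ hφ =>
    Ultrafilter.of_le _ (Filter.mem_iInf_of_mem (f := fun φ => Filter.principal (s φ)) ⟨φ, hφ⟩
      (Filter.mem_principal_self _))
  refine ⟨Ultrafilter.of (⨅ φ, Filter.principal (s φ)), fun φ => ?_⟩
  rw [Theory.CompleteType.formula_mem_typeOf]
  refine ⟨hU φ, fun h => by_contra fun hn => ?_⟩
  obtain ⟨x, h1, h2⟩ := (h.and (hU φ.not hn)).exists
  exact h2 h1

theorem type_ext {A : Set M} {k : ℕ} {p q : TypesOver L A k}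
    (h : ∀ φ : L[[A]].Formula (Fin k),
      Formula.equivSentence φ ∈ p ↔ Formula.equivSentence φ ∈ q) : p = q := by
  refine SetLike.ext fun φ => ?_
  obtain ⟨ψ, rfl⟩ := Formula.equivSentence.surjective φ
  exact h ψ

/-- The image of an ultrafilter on a finite type is principal. -/
theorem exists_eventually_eq {X Y : Type*} [Finite Y] (U : Ultrafilter X) (f : X → Y) :
    ∃ y, ∀ᶠ x in U, f x = y := by
  obtain ⟨y, hy⟩ := Ultrafilter.eq_pure_of_finite (U.map f)
  refine ⟨y, ?_⟩
  have : ∀ᶠ z in (U.map f : Filter Y), z = y := by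
    rw [hy]
    rfl
  exact this

end Types

/-! ### Closed sets of a block system -/

namespace BlockData

variable {M : Type*} {D : BlockData M} {d : ℕ}

/-- A set is closed if it contains all points of its blocks. -/
def Closed (D : BlockData M) (B : Set M) : Prop := ∀ y ∈ B, ∀ x, D.J x y → x ∈ B

/-- The smallest closed set containing `F`. -/
def cl (D : BlockData M) (F : Set M) : Set M := F ∪ ⋃ y ∈ F, {x | D.J x y}

theorem subset_cl (F : Set M) : F ⊆ D.cl F := Set.subset_union_left

theorem cl_mono {F G : Set M} (h : F ⊆ G) : D.cl F ⊆ D.cl G :=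
  Set.union_subset_union h (Set.biUnion_subset_biUnion_left h)

theorem Closed.union {B C : Set M} (hB : D.Closed B) (hC : D.Closed C) : D.Closed (B ∪ C) := by
  rintro y (hy | hy) x hx
  · exact Or.inl (hB y hy x hx)
  · exact Or.inr (hC y hy x hx)

theorem IsSystem.closed_cl (hD : D.IsSystem d) (F : Set M) : D.Closed (D.cl F) := by
  rintro y (hy | hy) x hx
  · exact Or.inr (Set.mem_biUnion hy hx)
  · obtain ⟨z, -, hz⟩ := Set.mem_iUnion₂.1 hy
    exact absurd (hD.inc hz).1 (hD.inc hx).2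

theorem IsSystem.finite_points (hD : D.IsSystem d) (y : M) : {x | D.J x y}.Finite := by
  by_cases hy : D.P y
  · exact Set.finite_empty.subset fun x hx => (hD.inc hx).2 hy
  · obtain ⟨S, -, h⟩ := hD.exists_points y hy
    exact S.finite_toSet.subset fun x hx => (h x).2 hx

theorem IsSystem.finite_cl (hD : D.IsSystem d) {F : Set M} (hF : F.Finite) : (D.cl F).Finite :=
  hF.union (hF.biUnion fun y _ => hD.finite_points y)

theorem IsSystem.countable_cl (hD : D.IsSystem d) {F : Set M} (hF : F.Countable) :
    (D.cl F).Countable :=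
  hF.union (hF.biUnion fun y _ => (hD.finite_points y).countable)

theorem Closed.partialIso_id {B : Set M} (hB : D.Closed B) (hfin : B.Finite) :
    PartialIso D D ((fun b => (b, b)) '' B) := by
  refine ⟨hfin.image _, ?_, ?_, ?_, ?_, ?_⟩
  · rintro _ ⟨x, -, rfl⟩ _ ⟨y, -, rfl⟩
    rfl
  · rintro _ ⟨x, -, rfl⟩
    rfl
  · rintro _ ⟨x, -, rfl⟩ _ ⟨y, -, rfl⟩
    rfl
  · rintro _ ⟨x, hx, rfl⟩ y hy
    exact ⟨_, ⟨y, hB x hx y hy, rfl⟩, rfl⟩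
  · rintro _ ⟨x, hx, rfl⟩ y hy
    exact ⟨_, ⟨y, hB x hx y hy, rfl⟩, rfl⟩

/-- The element `x` together with its points, if it is a block. -/
def hull (D : BlockData M) (x : M) : Set M := {z | z = x ∨ D.J z x}

theorem IsSystem.finite_hull (hD : D.IsSystem d) (x : M) : (D.hull x).Finite :=
  (Set.finite_singleton x).union (hD.finite_points x)

/-- The elements `x` and `x'` have the same type over the closed set `B`. -/
def SameTrace (D : BlockData M) (B : Set M) (x x' : M) : Prop :=
  (D.P x ↔ D.P x') ∧ ∀ z ∈ B, (z ∈ D.hull x ↔ z ∈ D.hull x')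

theorem SameTrace.symm {B : Set M} {x x' : M} (h : D.SameTrace B x x') : D.SameTrace B x' x :=
  ⟨h.1.symm, fun z hz => (h.2 z hz).symm⟩

theorem SameTrace.trans {B : Set M} {x y z : M} (h : D.SameTrace B x y)
    (h' : D.SameTrace B y z) : D.SameTrace B x z :=
  ⟨h.1.trans h'.1, fun u hu => (h.2 u hu).trans (h'.2 u hu)⟩

theorem SameTrace.mono {B C : Set M} (hBC : B ⊆ C) {x x' : M} (h : D.SameTrace C x x') :
    D.SameTrace B x x' :=
  ⟨h.1, fun z hz => h.2 z (hBC hz)⟩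

theorem SameTrace.eq_of_mem (hD : D.IsSystem d) {B : Set M} {x x' : M} (h : D.SameTrace B x x')
    (hx : x ∈ B) : x = x' :=
  ((h.2 x hx).1 (Or.inl rfl)).resolve_right fun hJ => (hD.inc hJ).2 (h.1.1 (hD.inc hJ).1)

/-- The identity of `B` extends by `x ↦ x'`: a new point has no incidence with `B`, and a new block
is handled by `exists_extend_block`. -/
theorem SameTrace.exists_partialIso (hD : D.IsSystem d) {B : Set M} (hB : D.Closed B)
    (hfin : B.Finite) {x x' : M} (h : D.SameTrace B x x') :
    ∃ R, PartialIso D D R ∧ (∀ b ∈ B, (b, b) ∈ R) ∧ (x, x') ∈ R := by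
  have hid := hB.partialIso_id hfin
  have hmem : ∀ b ∈ B, (b, b) ∈ (fun b => (b, b)) '' B := fun b hb => ⟨b, hb, rfl⟩
  by_cases hx : x ∈ B
  · obtain rfl := h.eq_of_mem hD hx
    exact ⟨_, hid, hmem, hmem _ hx⟩
  by_cases hx' : x' ∈ B
  · obtain rfl := h.symm.eq_of_mem hD hx'
    exact ⟨_, hid, hmem, hmem _ hx'⟩
  have hl : ∀ p ∈ (fun b => (b, b)) '' B, p.1 ≠ x := by
    rintro _ ⟨b, hb, rfl⟩ rfl
    exact hx hb
  have hr : ∀ p ∈ (fun b => (b, b)) '' B, p.2 ≠ x' := by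
    rintro _ ⟨b, hb, rfl⟩ rfl
    exact hx' hb
  by_cases hP : D.P x
  · exact ⟨_, hid.insert_point hD hD hP (h.1.1 hP) hl hr, fun b hb => Or.inr (hmem b hb), Or.inl rfl⟩
  · obtain ⟨R, h1, h2, h3⟩ := hid.exists_extend_block hD hD hP (fun h' => hP (h.1.2 h')) hl hr (by
      rintro _ ⟨b, hb, rfl⟩
      have := h.2 b hb
      have n1 : b ≠ x := fun e => hx (e ▸ hb)
      have n2 : b ≠ x' := fun e => hx' (e ▸ hb)
      simpa [hull, n1, n2] using this)
    exact ⟨R, h1, fun b hb => h2 (hmem b hb), h3⟩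

/-- Tuples which are closed as sets and satisfy the same atomic formulas over the closed set `B` are
matched by a partial isomorphism over `B`. -/
theorem Closed.partialIso_union_range {B : Set M} (hB : D.Closed B) (hfin : B.Finite)
    {ι : Type*} [Finite ι] {x y : ι → M} (hx : ∀ i z, D.J z (x i) → ∃ j, x j = z)
    (hy : ∀ i z, D.J z (y i) → ∃ j, y j = z) (heq : ∀ i j, x i = x j ↔ y i = y j)
    (hP : ∀ i, D.P (x i) ↔ D.P (y i)) (hJ : ∀ i j, D.J (x i) (x j) ↔ D.J (y i) (y j))
    (hxy : ∀ i, ∀ b ∈ B, (x i = b ↔ y i = b)) :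
    PartialIso D D ((fun b => (b, b)) '' B ∪ Set.range fun i => (x i, y i)) := by
  -- A point of a block in `B` is in `B` by closedness, and there the two tuples agree.
  have hJB : ∀ i, ∀ b ∈ B, (D.J (x i) b ↔ D.J (y i) b) := by
    intro i b hb
    constructor
    · intro h
      rw [(hxy i (x i) (hB b hb _ h)).1 rfl]
      exact h
    · intro h
      rw [(hxy i (y i) (hB b hb _ h)).2 rfl]
      exact h
  have hBJ : ∀ i, ∀ b ∈ B, (D.J b (x i) ↔ D.J b (y i)) := by
    intro i b hb
    constructor
    · intro h
      obtain ⟨j, rfl⟩ := hx i b h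
      rw [← (hxy j (x j) hb).1 rfl]
      exact (hJ j i).1 h
    · intro h
      obtain ⟨j, rfl⟩ := hy i b h
      rw [← (hxy j (y j) hb).2 rfl]
      exact (hJ j i).2 h
  have hid := hB.partialIso_id hfin
  refine ⟨hid.finite.union (Set.finite_range _), ?_, ?_, ?_, ?_, ?_⟩
  · rintro _ (⟨b, hb, rfl⟩ | ⟨i, rfl⟩) _ (⟨c, hc, rfl⟩ | ⟨j, rfl⟩)
    · rfl
    · exact eq_comm.trans ((hxy j b hb).trans eq_comm)
    · exact hxy i c hc
    · exact heq i j
  · rintro _ (⟨b, hb, rfl⟩ | ⟨i, rfl⟩)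
    · rfl
    · exact hP i
  · rintro _ (⟨b, hb, rfl⟩ | ⟨i, rfl⟩) _ (⟨c, hc, rfl⟩ | ⟨j, rfl⟩)
    · rfl
    · exact hBJ j b hb
    · exact hJB i c hc
    · exact hJ i j
  · rintro _ (⟨b, hb, rfl⟩ | ⟨i, rfl⟩) z hz
    · exact ⟨(z, z), Or.inl ⟨z, hB b hb z hz, rfl⟩, rfl⟩
    · obtain ⟨j, rfl⟩ := hx i z hz
      exact ⟨_, Or.inr ⟨j, rfl⟩, rfl⟩
  · rintro _ (⟨b, hb, rfl⟩ | ⟨i, rfl⟩) z hz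
    · exact ⟨(z, z), Or.inl ⟨z, hB b hb z hz, rfl⟩, rfl⟩
    · obtain ⟨j, rfl⟩ := hy i z hz
      exact ⟨_, Or.inr ⟨j, rfl⟩, rfl⟩

/-- A tuple enumerating the elements of `x` and their points. -/
theorem IsSystem.exists_enumeration (hD : D.IsSystem d) (k : ℕ) :
    ∃ c : (Fin k → M) → Fin k × Option (Fin d) → M, (∀ x i, c x (i, none) = x i) ∧
      ∀ x i z, D.J z (c x i) → ∃ j, c x j = z := by
  have : ∀ y, ∃ e : Fin d → M, (∀ z, D.J z y → ∃ j, e j = z) ∧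
      ∀ j z, ¬ D.J z (e j) := by
    intro y
    by_cases hy : D.P y
    · exact ⟨fun _ => y, fun z hz => absurd hy (hD.inc hz).2, fun _ z hz => (hD.inc hz).2 hy⟩
    · obtain ⟨S, hS, h⟩ := hD.exists_points y hy
      refine ⟨fun j => (S.equivFinOfCardEq hS).symm j, fun z hz =>
        ⟨S.equivFinOfCardEq hS ⟨z, (h z).2 hz⟩, by simp⟩, fun j z hz => ?_⟩
      exact (hD.inc hz).2 (hD.inc ((h _).1 (Subtype.prop _))).1
  choose e he he' using this
  refine ⟨fun x i => i.2.elim (x i.1) (e (x i.1)), fun x i => rfl, ?_⟩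
  rintro x ⟨i, _ | j⟩ z hz
  · obtain ⟨j, hj⟩ := he _ z hz
    exact ⟨(i, some j), hj⟩
  · exact absurd hz (he' _ _ _)

end BlockData

/-! ### Saturation and stability of block structures -/

section BlockStructure

variable {b : Bool} {M : Type w} [incLang.Structure M] {d : ℕ}

/-- Formulas with parameters are preserved by the partial isomorphisms fixing the finitely many
parameters which occur. -/
theorem exists_finite_support (hM : IsBlockStructure b M d) {A : Set M} {α : Type*}
    (φ : incLang[[A]].Formula α) : ∃ F : Set M, F.Finite ∧ F ⊆ A ∧
      ∀ R, (blockData b M).PartialIso (blockData b M) R → (∀ a ∈ F, (a, a) ∈ R) →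
        ∀ x y : α → M, (∀ i, (x i, y i) ∈ R) → (φ.Realize x ↔ φ.Realize y) := by
  classical
  -- Parameters become free variables, only finitely many of which occur.
  have hφ : ∀ x : α → M, (BoundedFormula.constantsVarsEquiv φ).Realize
      (Sum.elim (fun a : A => (a : M)) x) default ↔ φ.Realize x := fun x => by
    have := BoundedFormula.realize_constantsVarsEquiv (φ := φ) (v := x) (xs := default)
    simp only [coe_con] at this
    exact this
  refine ⟨Subtype.val '' {a : A | Sum.inl a ∈ (BoundedFormula.constantsVarsEquiv φ).freeVarFinset},
    Set.Finite.image _ (Set.Finite.preimage Sum.inl_injective.injOn (Finset.finite_toSet _)),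
    by rintro _ ⟨a, -, rfl⟩; exact a.2, ?_⟩
  intro R hR hF x y hxy
  rw [← hφ x, ← hφ y]
  refine realize_iff_of_partialIso hM hM _ hR ?_ (fun i => i.elim0)
  rintro (a | i) hi
  · exact hF _ ⟨a, hi, rfl⟩
  · exact hxy i

/-- The closure of `A` is finite, so the ultrafilter of the type concentrates on a single trace. Any
element with that trace realizes the type. -/
theorem isOmegaSaturated_of_isBlockStructure [Nonempty M] (hM : IsBlockStructure b M d) :
    IsOmegaSaturated incLang M := by
  intro A hA p
  obtain ⟨U, hU⟩ := exists_ultrafilter p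
  set D := blockData b M
  have hD : D.IsSystem d := hM.isSystem
  have hfin := hD.finite_cl hA
  have : Finite (D.cl A) := hfin
  obtain ⟨q, hq⟩ := exists_eventually_eq U fun x =>
    (D.P (x 0), {z : D.cl A | (z : M) ∈ D.hull (x 0)})
  obtain ⟨x, hx⟩ := hq.exists
  refine ⟨x, type_ext fun φ => ?_⟩
  rw [Theory.CompleteType.formula_mem_typeOf, hU]
  obtain ⟨F, -, hFA, hF⟩ := exists_finite_support hM φ
  have : ∀ᶠ y : Fin 1 → M in U, (φ.Realize y ↔ φ.Realize x) := by
    filter_upwards [hq] with y hy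
    rw [← hx] at hy
    have h1 : D.P (y 0) = D.P (x 0) := congrArg Prod.fst hy
    have h2 : {z : D.cl A | (z : M) ∈ D.hull (y 0)} = {z : D.cl A | (z : M) ∈ D.hull (x 0)} :=
      congrArg Prod.snd hy
    have hs : D.SameTrace (D.cl A) (y 0) (x 0) :=
      ⟨iff_of_eq h1, fun z hz => Set.ext_iff.1 h2 ⟨z, hz⟩⟩
    obtain ⟨R, hR, hRB, hyx⟩ := hs.exists_partialIso hD (hD.closed_cl A) hfin
    exact hF R hR (fun a ha => hRB a (D.subset_cl A (hFA ha))) y x fun i => by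
      rwa [Subsingleton.elim i 0]
  rw [Filter.eventually_congr this, Filter.eventually_const]

/-- A type is coded by the atomic pattern of the enumerated closure of the tuple (finitely many
possibilities) and by which coordinates equal which elements of `D.cl A` (countably many). -/
theorem countable_typesOver (hM : IsBlockStructure b M d) [Nonempty M] {A : Set M}
    (hA : A.Countable) (k : ℕ) : Countable (TypesOver incLang A k) := by
  classical
  set D := blockData b M
  have hD : D.IsSystem d := hM.isSystem
  obtain ⟨c, hc0, hc⟩ := hD.exists_enumeration k
  choose U hU using fun p : TypesOver incLang A k => exists_ultrafilter p
  let ι := Fin k × Option (Fin d)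
  let pat : (Fin k → M) → (ι → ι → Prop) × (ι → Prop) × (ι → ι → Prop) := fun x =>
    (fun i j => c x i = c x j, fun i => D.P (c x i), fun i j => D.J (c x i) (c x j))
  choose q hq using fun p => exists_eventually_eq (U p) pat
  -- `none` records that the coordinate eventually avoids each single element of `D.cl A`. This
  -- suffices since each formula involves only finitely many of them.
  have ho : ∀ p (i : ι), ∃ o : Option (D.cl A), ∀ z : D.cl A,
      (o = some z ↔ ∀ᶠ x in U p, c x i = z) := by
    intro p i
    by_cases h : ∃ z : D.cl A, ∀ᶠ x in U p, c x i = z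
    · obtain ⟨z, hz⟩ := h
      refine ⟨some z, fun z' => ⟨fun e => Option.some.inj e ▸ hz, fun hz' => ?_⟩⟩
      obtain ⟨x, h1, h2⟩ := (hz.and hz').exists
      exact congrArg some (Subtype.ext (h1.symm.trans h2))
    · exact ⟨none, fun z => ⟨fun e => (Option.some_ne_none z e.symm).elim,
        fun hz => (h ⟨z, hz⟩).elim⟩⟩
  choose o ho using ho
  have : Countable (D.cl A) := hD.countable_cl hA
  have hinj : Function.Injective fun p => (o p, q p) := by
    intro p p' h
    have hop : o p = o p' := congrArg Prod.fst h
    have hqp : q p = q p' := congrArg Prod.snd h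
    refine type_ext fun φ => ?_
    obtain ⟨F, hFfin, hFA, hF⟩ := exists_finite_support hM φ
    have hfin := hD.finite_cl hFfin
    have hsub : D.cl F ⊆ D.cl A := D.cl_mono hFA
    have : Finite (D.cl F) := hfin
    have hev : ∀ p, ∀ᶠ x in U p, ∀ i, ∀ z : D.cl F,
        (c x i = z ↔ o p i = some ⟨z, hsub z.2⟩) := by
      intro p
      refine Filter.eventually_all.2 fun i => Filter.eventually_all.2 fun z => ?_
      by_cases h : o p i = some ⟨z, hsub z.2⟩
      · exact ((ho p i _).1 h).mono fun x hx => iff_of_true hx h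
      · exact (Ultrafilter.eventually_not.2 fun h' => h ((ho p i _).2 h')).mono
          fun x hx => iff_of_false hx h
    have hφ : ∀ p, ∀ᶠ x : Fin k → M in U p, (φ.Realize x ↔ Formula.equivSentence φ ∈ p) := by
      intro p
      by_cases h : Formula.equivSentence φ ∈ p
      · exact ((hU p φ).1 h).mono fun x hx => iff_of_true hx h
      · exact (Ultrafilter.eventually_not.2 fun h' => h ((hU p φ).2 h')).mono
          fun x hx => iff_of_false hx h
    obtain ⟨x, ⟨hx1, hx2⟩, hx3⟩ := (((hev p).and (hq p)).and (hφ p)).exists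
    obtain ⟨y, ⟨hy1, hy2⟩, hy3⟩ := (((hev p').and (hq p')).and (hφ p')).exists
    rw [← hx3, ← hy3]
    have hxy : pat x = pat y := hx2.trans (hqp.trans hy2.symm)
    have e1 := congrArg Prod.fst hxy
    have e2 := congrArg (fun t => t.2.1) hxy
    have e3 := congrArg (fun t => t.2.2) hxy
    have hR := (hD.closed_cl F).partialIso_union_range hfin (hc x) (hc y)
      (fun i j => iff_of_eq (congrFun (congrFun e1 i) j)) (fun i => iff_of_eq (congrFun e2 i))
      (fun i j => iff_of_eq (congrFun (congrFun e3 i) j))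
      (fun i z hz => (hx1 i ⟨z, hz⟩).trans (by rw [hop]; exact (hy1 i ⟨z, hz⟩).symm))
    refine hF _ hR (fun a ha => Or.inl ⟨a, D.subset_cl F ha, rfl⟩) x y fun i => ?_
    exact Or.inr ⟨(i, none), by simp only [hc0]⟩
  exact hinj.countable

end BlockStructure
/-! ### Morley rank -/

section MorleyRank

variable {L : FirstOrder.Language.{u, v}} {M : Type w} [L.Structure M]

theorem morleyRankGE_zero {X : Set M} : MorleyRankGE L M ((0 : ℕ) : Ordinal.{w}) X ↔ X.Nonempty := by
  rw [Nat.cast_zero, MorleyRankGE, Ordinal.limitRecOn_zero]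

theorem morleyRankGE_succ {n : ℕ} {X : Set M} :
    MorleyRankGE L M ((n + 1 : ℕ) : Ordinal.{w}) X ↔ ∃ E : ℕ → Set M,
      (∀ i, (Set.univ : Set M).Definable₁ L (E i)) ∧ (∀ i, E i ⊆ X) ∧
      (∀ i j, i ≠ j → Disjoint (E i) (E j)) ∧
      ∀ i, MorleyRankGE L M (n : Ordinal.{w}) (E i) := by
  rw [Nat.cast_succ, MorleyRankGE, Ordinal.limitRecOn_add_one]
  rfl

end MorleyRank

/-! ### Independence and amalgamation -/

namespace BlockData

variable {M : Type*} {D : BlockData M} {d : ℕ}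

/-- Every type over `B` has an extension to `B'` which is independent of `B'` over `B`. -/
theorem IsSystem.exists_independent (hD : D.IsSystem d) {B B' : Set M} (hB : D.Closed B)
    (hBB' : B ⊆ B') (hfin : B'.Finite) (x : M) :
    ∃ x', D.SameTrace B x' x ∧ ∀ z ∈ B', z ∈ D.hull x' → z ∈ B := by
  classical
  by_cases hx : x ∈ B
  · refine ⟨x, ⟨Iff.rfl, fun _ _ => Iff.rfl⟩, ?_⟩
    rintro z - (rfl | hz)
    · exact hx
    · exact hB x hx z hz
  by_cases hP : D.P x
  · obtain ⟨x', hP', hx'⟩ := hD.exists_point_notMem hfin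
    have h : ∀ z ∈ B', z ∉ D.hull x' := by
      rintro z hz (rfl | h)
      · exact hx' hz
      · exact (hD.inc h).2 hP'
    refine ⟨x', ⟨iff_of_true hP' hP, fun z hz => iff_of_false (h z (hBB' hz)) ?_⟩,
      fun z hz hz' => absurd hz' (h z hz)⟩
    rintro (rfl | h)
    · exact hx hz
    · exact (hD.inc h).2 hP
  · obtain ⟨S, hS, hSx⟩ := hD.exists_points x hP
    -- The new block keeps the points of `x` in `B` and meets `B'` nowhere else.
    obtain ⟨x', hP', hx', hT⟩ := hD.exists_block hfin (S.filter (· ∈ B))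
      ((Finset.card_filter_le _ _).trans hS.le)
      (fun z hz => (hD.inc ((hSx z).1 (Finset.mem_filter.1 hz).1)).1)
    refine ⟨x', ⟨iff_of_false hP' hP, fun z hz => ?_⟩, ?_⟩
    · have n1 : z ≠ x := fun e => hx (e ▸ hz)
      have n2 : z ≠ x' := fun e => hx' (e ▸ hBB' hz)
      have := hT z (hBB' hz)
      simp only [Finset.mem_filter, hz, and_true, hSx] at this
      simp [hull, n1, n2, this]
    · rintro z hz (rfl | h)
      · exact absurd hz hx'
      · exact (Finset.mem_filter.1 ((hT z hz).2 h)).2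

/-- Independent extensions of the same type over `B` to `C` and to `C'` have a common
realization. -/
theorem SameTrace.exists_amalgam (hD : D.IsSystem d) {B C C' : Set M} (hB : D.Closed B)
    (hBC : B ⊆ C) (hC : C.Finite) (hC' : C'.Finite) {x x' : M}
    (h : D.SameTrace B x x') (hx : ∀ z ∈ C, z ∈ D.hull x → z ∈ B)
    (hx' : ∀ z ∈ C', z ∈ D.hull x' → z ∈ B) :
    ∃ y, D.SameTrace C y x ∧ D.SameTrace C' y x' := by
  -- One realization independent of `C ∪ C'` over `B` serves both sides, since an independent
  -- element's trace is determined by its trace on `B`.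
  obtain ⟨y, hyx, hy⟩ := hD.exists_independent hB (hBC.trans Set.subset_union_left)
    (hC.union hC') x
  refine ⟨y, ⟨hyx.1, fun z hz => ⟨fun hzy => ?_, fun hzx => ?_⟩⟩,
    (hyx.trans h).1, fun z hz => ⟨fun hzy => ?_, fun hzx => ?_⟩⟩
  · exact (hyx.2 z (hy z (Or.inl hz) hzy)).1 hzy
  · exact (hyx.2 z (hx z hz hzx)).2 hzx
  · exact ((hyx.trans h).2 z (hy z (Or.inr hz) hzy)).1 hzy
  · exact ((hyx.trans h).2 z (hx' z hz hzx)).2 hzx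

theorem IsSystem.ncard_hull_le (hD : D.IsSystem d) (x : M) : (D.hull x).ncard ≤ d + 1 := by
  have hle : {z | D.J z x}.ncard ≤ d := by
    by_cases hx : D.P x
    · have : {z | D.J z x} = ∅ :=
        Set.eq_empty_of_forall_notMem fun z hz => (hD.inc hz).2 hx
      simp [this]
    · obtain ⟨S, hS, h⟩ := hD.exists_points x hx
      have : {z | D.J z x} = S := Set.ext fun z => (h z).symm
      rw [this, Set.ncard_coe_finset, hS]
  exact (Set.ncard_insert_le _ _).trans (Nat.succ_le_succ hle)

end BlockData

/-! ### Upper bound for the rank -/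

section BlockStructure

variable {b : Bool} {M : Type w} [incLang.Structure M] {d : ℕ}

theorem exists_closed_support (hM : IsBlockStructure b M d) {X : Set M}
    (hX : (Set.univ : Set M).Definable₁ incLang X) :
    ∃ B : Set M, B.Finite ∧ (blockData b M).Closed B ∧
      ∀ x x', (blockData b M).SameTrace B x x' → (x ∈ X ↔ x' ∈ X) := by
  obtain ⟨φ, hφ⟩ := hX
  have hφ' : ∀ x, x ∈ X ↔ φ.Realize fun _ : Fin 1 => x := fun x =>
    Set.ext_iff.1 hφ fun _ => x
  obtain ⟨F, hFfin, -, hF⟩ := exists_finite_support hM φ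
  have hD := hM.isSystem
  refine ⟨_, hD.finite_cl hFfin, hD.closed_cl F, fun x x' h => ?_⟩
  obtain ⟨R, hR, hRB, hxx'⟩ := h.exists_partialIso hD (hD.closed_cl F) (hD.finite_cl hFfin)
  rw [hφ', hφ']
  exact hF R hR (fun a ha => hRB a (BlockData.subset_cl F ha)) _ _ fun _ => hxx'

/-- If every element of `X` had at most `n` new elements in its hull over `B`, the witnesses in the
disjoint pieces `E i` would be independent of the parameters `C i` over `B`. Two of them share a
trace on the finite set `B`, and their amalgam lies in two disjoint pieces. -/
theorem exists_le_ncard_of_morleyRankGE (hM : IsBlockStructure b M d) (n : ℕ) :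
    ∀ {X B : Set M}, B.Finite → (blockData b M).Closed B →
      MorleyRankGE incLang M (n : Ordinal.{w}) X →
      ∃ x ∈ X, n ≤ ((blockData b M).hull x \ B).ncard := by
  have hD := hM.isSystem
  set D := blockData b M
  induction n with
  | zero =>
    intro X B _ _ h
    obtain ⟨x, hx⟩ := morleyRankGE_zero.1 h
    exact ⟨x, hx, Nat.zero_le _⟩
  | succ n ih =>
    intro X B hB hBc h
    obtain ⟨E, hE, hEX, hdisj, hrank⟩ := morleyRankGE_succ.1 h
    choose C hC hCc hCE using fun i => exists_closed_support hM (hE i)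
    choose x hxE hx using fun i => ih (hB.union (hC i)) (hBc.union (hCc i)) (hrank i)
    by_contra! hlt
    have hind : ∀ i, ∀ z ∈ B ∪ C i, z ∈ D.hull (x i) → z ∈ B := by
      intro i z hz hzx
      by_contra hzB
      have hsub : D.hull (x i) \ (B ∪ C i) ⊆ D.hull (x i) \ B :=
        Set.sdiff_subset_sdiff_right Set.subset_union_left
      -- At least `n` elements outside `B ∪ C i` and at most `n` outside `B`: the two sets coincide.
      have heq := Set.eq_of_subset_of_ncard_le hsub
        ((Nat.lt_succ_iff.1 (hlt _ (hEX i (hxE i)))).trans (hx i)) ((hD.finite_hull _).sdiff)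
      have hmem : z ∈ D.hull (x i) \ (B ∪ C i) := heq ▸ ⟨hzx, hzB⟩
      exact hmem.2 hz
    have : Finite B := hB
    obtain ⟨i, j, hij, htr⟩ := Finite.exists_ne_map_eq_of_infinite
      fun i => (D.P (x i), {z : B | (z : M) ∈ D.hull (x i)})
    have hsame : D.SameTrace B (x i) (x j) :=
      ⟨iff_of_eq (congrArg Prod.fst htr), fun z hz =>
        Set.ext_iff.1 (congrArg Prod.snd htr) ⟨z, hz⟩⟩
    obtain ⟨y, hyi, hyj⟩ := hsame.exists_amalgam hD hBc Set.subset_union_left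
      (hB.union (hC i)) (hB.union (hC j)) (hind i) (hind j)
    exact Set.disjoint_left.1 (hdisj i j hij)
      ((hCE i _ _ (hyi.mono Set.subset_union_right)).2 (hxE i))
      ((hCE j _ _ (hyj.mono Set.subset_union_right)).2 (hxE j))

theorem not_morleyRankGE (hM : IsBlockStructure b M d) :
    ¬ MorleyRankGE incLang M ((d + 1 : ℕ) + 1 : Ordinal.{w}) Set.univ := by
  intro h
  rw [← Nat.cast_succ] at h
  obtain ⟨x, -, hx⟩ := exists_le_ncard_of_morleyRankGE hM _ Set.finite_empty (B := ∅)
    (fun _ h => h.elim) h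
  have := hM.isSystem.ncard_hull_le x
  rw [Set.sdiff_empty] at hx
  omega

/-! ### Lower bound for the rank -/

theorem definable_point (b : Bool) :
    (Set.univ : Set M).Definable incLang {x : Fin 1 → M | (blockData b M).P (x 0)} := by
  refine Set.definable_iff_exists_formula_sum.2
    ⟨Relations.formula₁ (cond b lnSym ptSym) (Term.var (Sum.inr 0)), ?_⟩
  ext x
  simp only [Set.mem_ofPred_eq, Formula.realize_rel₁, Term.realize_var, Sum.elim_inr]
  rfl

theorem definable_inc (b : Bool) (a : M) :
    (Set.univ : Set M).Definable incLang {x : Fin 1 → M | (blockData b M).J a (x 0)} := by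
  refine Set.definable_iff_exists_formula_sum.2
    ⟨cond b (Relations.formula₂ incSym (Term.var (Sum.inr 0)) (Term.var (Sum.inl ⟨a, trivial⟩)))
      (Relations.formula₂ incSym (Term.var (Sum.inl ⟨a, trivial⟩)) (Term.var (Sum.inr 0))), ?_⟩
  ext x
  cases b <;>
  · simp only [Set.mem_ofPred_eq, cond_true, cond_false, Formula.realize_rel₂, Term.realize_var,
      Sum.elim_inr, Sum.elim_inl]
    rfl

/-- The blocks which contain all points in `F` and none in `G`. -/
def blocksThrough (b : Bool) (F G : Finset M) : Set M :=
  {y | ¬ (blockData b M).P y ∧ (∀ x ∈ F, (blockData b M).J x y) ∧ ∀ x ∈ G, ¬ (blockData b M).J x y}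

theorem definable_blocksThrough (F G : Finset M) :
    (Set.univ : Set M).Definable₁ incLang (blocksThrough b F G) := by
  have h := ((definable_point (M := M) b).compl.inter
    (Set.definable_biInter_finset (fun a => definable_inc (M := M) b a) F)).inter
    (Set.definable_biInter_finset (fun a => (definable_inc (M := M) b a).compl) G)
  refine (congrArg (Set.Definable Set.univ incLang) ?_).mp h
  ext x
  simp [blocksThrough, and_assoc]

/-- Each of the `n` unchosen points of a block accounts for one unit of rank, and the choice among
blocks with the same points for one more. Allowing any superset `X` builds in monotonicity. -/
theorem morleyRankGE_of_blocksThrough_subset (hM : IsBlockStructure b M d) (n : ℕ) :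
    ∀ (F G : Finset M), F.card + n = d → (∀ x ∈ F, (blockData b M).P x) → Disjoint F G →
      ∀ X : Set M, blocksThrough b F G ⊆ X →
        MorleyRankGE incLang M ((n + 1 : ℕ) : Ordinal.{w}) X := by
  classical
  have hD := hM.isSystem
  induction n with
  | zero =>
    intro F G hF hP hFG X hX
    -- Here `F` has `d` points, so it is the whole point set of infinitely many blocks, whose
    -- singletons have rank at least `0`.
    have hinf := hD.infinite_fiber F hF hP
    refine morleyRankGE_succ.2 ⟨fun i => {(hinf.natEmbedding _ i : M)}, fun i => ?_, fun i => ?_,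
      fun i j hij => ?_, fun i => morleyRankGE_zero.2 (Set.singleton_nonempty _)⟩
    · exact Set.Definable.singleton_of_mem incLang (Set.mem_univ _)
    · rintro _ rfl
      obtain ⟨h1, h2⟩ := (hinf.natEmbedding _ i).2
      exact hX ⟨h1, fun x hx => (h2 x).1 hx, fun x hx hJ =>
        Finset.disjoint_left.1 hFG ((h2 x).2 hJ) hx⟩
    · exact Set.disjoint_singleton.2 fun h => hij ((hinf.natEmbedding _).injective (Subtype.ext h))
  | succ n ih =>
    intro F G hF hP hFG X hX
    have hinf := hD.infinite_points.sdiff (F ∪ G).finite_toSet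
    set p : ℕ → M := fun i => hinf.natEmbedding _ i
    have hp : Function.Injective p := Subtype.val_injective.comp (hinf.natEmbedding _).injective
    have hpP : ∀ i, (blockData b M).P (p i) := fun i => (hinf.natEmbedding _ i).2.1
    have hpF : ∀ i, p i ∉ F ∧ p i ∉ G := fun i => by
      simpa using (hinf.natEmbedding _ i).2.2
    -- Requiring `p i` while excluding all earlier `p j` makes the pieces disjoint; recording these
    -- exclusions is the purpose of `G`.
    have hlt : ∀ i j, i < j → Disjoint
        (blocksThrough b (insert (p i) F) (G ∪ (Finset.range i).image p))
        (blocksThrough b (insert (p j) F) (G ∪ (Finset.range j).image p)) := by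
      refine fun i j hij => Set.disjoint_left.2 fun y hi hj => ?_
      exact hj.2.2 (p i) (Finset.mem_union_right _ (Finset.mem_image_of_mem _
        (Finset.mem_range.2 hij))) (hi.2.1 _ (Finset.mem_insert_self _ _))
    refine morleyRankGE_succ.2
      ⟨fun i => blocksThrough b (insert (p i) F) (G ∪ (Finset.range i).image p),
      fun i => definable_blocksThrough _ _, fun i y hy => hX ⟨hy.1,
        fun x hx => hy.2.1 x (Finset.mem_insert_of_mem hx),
        fun x hx => hy.2.2 x (Finset.mem_union_left _ hx)⟩, fun i j hij => ?_, fun i => ?_⟩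
    · rcases hij.lt_or_gt with h | h
      · exact hlt i j h
      · exact (hlt j i h).symm
    · refine ih _ _ ?_ ?_ ?_ _ le_rfl
      · rw [Finset.card_insert_of_notMem (hpF i).1]
        omega
      · intro x hx
        rcases Finset.mem_insert.1 hx with rfl | hx
        · exact hpP i
        · exact hP x hx
      · rw [Finset.disjoint_left]
        intro x hx hx'
        rcases Finset.mem_insert.1 hx with rfl | hx <;>
          rcases Finset.mem_union.1 hx' with hx' | hx'
        · exact (hpF i).2 hx'
        · obtain ⟨j, hj, e⟩ := Finset.mem_image.1 hx'
          exact (Finset.mem_range.1 hj).ne (hp e)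
        · exact Finset.disjoint_left.1 hFG hx hx'
        · obtain ⟨j, hj, rfl⟩ := Finset.mem_image.1 hx'
          exact (hpF j).1 hx

end BlockStructure

theorem isOmegaStable_TheoryT (b : Bool) (d : ℕ) :
    IsOmegaStable.{0, 0, w} (TheoryT (cond b 1 (d + 1)) (cond b (d + 1) 1)) :=
  ⟨isComplete_TheoryT b d, fun M _ hA k =>
    countable_typesOver (model_iff_isBlockStructure.1 M.is_model) hA k⟩

theorem hasMorleyRank_TheoryT (b : Bool) (d : ℕ) :
    HasMorleyRank.{0, 0, w} (TheoryT (cond b 1 (d + 1)) (cond b (d + 1) 1))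
      ((d + 1 : ℕ) : Ordinal.{w}) := by
  constructor
  · obtain ⟨N⟩ := isSatisfiable_TheoryT b d
    let M : Theory.ModelType.{0, 0, w} _ := Theory.ModelType.ulift.{0, 0, 0, w} N
    exact ⟨M, isOmegaSaturated_of_isBlockStructure (model_iff_isBlockStructure.1 M.is_model)⟩
  · intro M _
    have hM := model_iff_isBlockStructure.1 M.is_model
    exact ⟨morleyRankGE_of_blocksThrough_subset hM d ∅ ∅ (by simp) (by simp) (by simp) _
      (Set.subset_univ _), not_morleyRankGE hM⟩

end StableInc

theorem theorem4p26 :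
    (∀ m : ℕ, 1 ≤ m →
      StableInc.IsOmegaStable.{0, 0, w} (StableInc.TheoryT m 1) ∧
      StableInc.HasMorleyRank.{0, 0, w} (StableInc.TheoryT m 1) (m : Ordinal.{w})) ∧
    (∀ n : ℕ, 1 ≤ n →
      StableInc.IsOmegaStable.{0, 0, w} (StableInc.TheoryT 1 n) ∧
      StableInc.HasMorleyRank.{0, 0, w} (StableInc.TheoryT 1 n) (n : Ordinal.{w})) := by
  refine ⟨fun m hm => ?_, fun n hn => ?_⟩
  · obtain ⟨d, rfl⟩ := Nat.exists_eq_add_of_le' hm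
    exact ⟨StableInc.isOmegaStable_TheoryT false d, StableInc.hasMorleyRank_TheoryT false d⟩
  · obtain ⟨d, rfl⟩ := Nat.exists_eq_add_of_le' hn
    exact ⟨StableInc.isOmegaStable_TheoryT true d, StableInc.hasMorleyRank_TheoryT true d⟩
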